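/- Oriented matroids are given by their covectors in $\{+,-,0\}^E$, $E$ finite, with the order induced by $0\prec +,-$ componentwise; the rank is the length of the maximal chains of covectors, topes are the maximal covectors, and an oriented matroid is acyclic if the all-positive vector is a tope. An oriented matroid $\mathcal S$ on the pairs $(i,j)$, $1\le i<j\le n$, is a sweep oriented matroid if each of its covectors $X$ is a covector of the braid oriented matroid, that is, $X_{(i,j)}=\operatorname{sign}(p_X(j)-p_X(i))$ for a (unique) ordered partition $p_X:[n]\twoheadrightarrow[l_X]$. Its big oriented matroid on $[n]\cup\{(i,j): i<j\}$ has as covectors all vectors $X^k$, for $X$ a covector of $\mathcal S$ and $1\le k\le 2l_X+1$, where $X^k_{(i,j)}=X_{(i,j)}$ and $X^k_i$ is $-$ if $p_X(i)\le\lfloor (k-1)/2\rfloor$, is $+$ if $p_X(i)>\lfloor k/2\rfloor$, and is $0$ otherwise. Its little oriented matroid is the restriction of the big one to $[n]$. Call $(\mathcal R,U,T)$ a Richter-Gebert triple if $\mathcal R$ is an oriented matroid of rank $4$ on $[12]$, $U$ and $T$ are topes of $\mathcal R$, $U$ has no zero entry, and no extending pseudoplane intersects $U$ and $T$ simultaneously,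 that is: there is no oriented matroid $\mathcal R'$ of rank $4$ on $[12]\cup\{f\}$, with $f$ not a loop and with $\mathcal R'|_{[12]}=\mathcal R$, that has covectors $U',T'$ with $U'_f=T'_f=0$, $0\ne U'|_{[12]}\preceq U$ and $0\ne T'|_{[12]}\preceq T$. Theorem. (1) A Richter-Gebert triple exists. (2) For every Richter-Gebert triple $(\mathcal R,U,T)$, the reorientation of $\mathcal R$ that sends $U$ to the all-positive vector is acyclic, but it is not the little oriented matroid of any sweep oriented matroid. (3) Hence there is an acyclic oriented matroid of rank $4$ on $12$ elements that does not extend to a big oriented matroid, i.e. that is not the restriction to $[12]$ of the big oriented matroid of a sweep oriented matroid. -/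

import Mathlib

/-! Sign vectors `E → SignType`, with entries `0`, `1`, `-1`. -/

namespace SignVec

variable {E : Type*}

/-- Composition: `X e` where it is nonzero, and `Y e` elsewhere. -/
def comp (X Y : E → SignType) : E → SignType := fun e => if X e = 0 then Y e else X e

/-- `e` separates `X` and `Y`: one of the two entries is `+` and the other is `-`. -/
def Separates (X Y : E → SignType) (e : E) : Prop := X e ≠ 0 ∧ Y e = -X e

/-- The componentwise order induced by `0 ≺ +` and `0 ≺ -`
(this is not the pointwise order of `SignType`, for which `-1 < 0 < 1`). -/
def Conf (X Y : E → SignType) : Prop := ∀ e, X e = 0 ∨ X e = Y e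

open Classical in
/-- Reorientation of a sign vector on the set `F`. -/
noncomputable def reorient (F : Set E) (X : E → SignType) : E → SignType :=
  fun e => if e ∈ F then -X e else X e

end SignVec

open SignVec in
/-- An oriented matroid on the ground set `E`, given by its covectors. -/
@[ext] structure OrientedMatroid (E : Type*) where
  covectors : Set (E → SignType)
  zero_mem : (fun _ => 0) ∈ covectors
  neg_mem : ∀ X ∈ covectors, (fun e => -X e) ∈ covectors
  comp_mem : ∀ X ∈ covectors, ∀ Y ∈ covectors, comp X Y ∈ covectors
  elim : ∀ X ∈ covectors, ∀ Y ∈ covectors, ∀ e, Separates X Y e →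
    ∃ Z ∈ covectors, Z e = 0 ∧ ∀ f, ¬ Separates X Y f → Z f = comp X Y f

namespace OrientedMatroid

open SignVec

variable {E F : Type*}

/-- There is a strict chain `X₀ ≺ X₁ ≺ ⋯ ≺ X_k` of length `k` of covectors. -/
def HasChain (M : OrientedMatroid E) (k : ℕ) : Prop :=
  ∃ X : ℕ → E → SignType, (∀ i ≤ k, X i ∈ M.covectors) ∧
    ∀ i < k, Conf (X i) (X (i + 1)) ∧ X i ≠ X (i + 1)

/-- `M` has rank `r`: the longest chains in the poset of covectors have length `r`. -/
def HasRank (M : OrientedMatroid E) (r : ℕ) : Prop := IsGreatest {k | M.HasChain k} r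

/-- Topes are the maximal covectors. -/
def IsTope (M : OrientedMatroid E) (T : E → SignType) : Prop :=
  T ∈ M.covectors ∧ ∀ Y ∈ M.covectors, Conf T Y → Y = T

/-- `M` is acyclic if the all-positive sign vector is a tope. -/
def IsAcyclic (M : OrientedMatroid E) : Prop := M.IsTope (fun _ => 1)

/-- A loop is an element at which all covectors vanish. -/
def IsLoop (M : OrientedMatroid E) (e : E) : Prop := ∀ X ∈ M.covectors, X e = 0

/-- The restriction of `M` to (the image of) a subset of the ground set, relabelled along `φ`. -/
def restrict (M : OrientedMatroid E) (φ : F ↪ E) : OrientedMatroid F where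
  covectors := {Y | ∃ X ∈ M.covectors, Y = fun f => X (φ f)}
  zero_mem := ⟨_, M.zero_mem, rfl⟩
  neg_mem := by
    rintro _ ⟨X, hX, rfl⟩
    exact ⟨_, M.neg_mem X hX, rfl⟩
  comp_mem := by
    rintro _ ⟨X, hX, rfl⟩ _ ⟨Y, hY, rfl⟩
    exact ⟨_, M.comp_mem X hX Y hY, rfl⟩
  elim := by
    rintro _ ⟨X, hX, rfl⟩ _ ⟨Y, hY, rfl⟩ e he
    obtain ⟨Z, hZ, hZe, hZf⟩ := M.elim X hX Y hY (φ e) he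
    exact ⟨_, ⟨Z, hZ, rfl⟩, hZe, fun f hf => hZf (φ f) hf⟩

/-- The reorientation of `M` on the set `A` of elements. -/
noncomputable def reorient (M : OrientedMatroid E) (A : Set E) : OrientedMatroid E where
  covectors := {Y | ∃ X ∈ M.covectors, Y = SignVec.reorient A X}
  zero_mem := ⟨_, M.zero_mem, by funext e; simp [SignVec.reorient]⟩
  neg_mem := by
    rintro _ ⟨X, hX, rfl⟩
    refine ⟨_, M.neg_mem X hX, ?_⟩
    funext e
    by_cases h : e ∈ A <;> simp [SignVec.reorient, h]
  comp_mem := by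
    rintro _ ⟨X, hX, rfl⟩ _ ⟨Y, hY, rfl⟩
    refine ⟨_, M.comp_mem X hX Y hY, ?_⟩
    funext e
    by_cases h : e ∈ A <;> by_cases h0 : X e = 0 <;> simp [SignVec.reorient, SignVec.comp, h, h0]
  elim := by
    rintro _ ⟨X, hX, rfl⟩ _ ⟨Y, hY, rfl⟩ e he
    have key : ∀ f, Separates (SignVec.reorient A X) (SignVec.reorient A Y) f ↔
        Separates X Y f := by
      intro f
      simp only [SignVec.reorient, Separates]
      generalize X f = x
      generalize Y f = y
      split_ifs <;> revert x y <;> decide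
    obtain ⟨Z, hZ, hZe, hZf⟩ := M.elim X hX Y hY e ((key e).1 he)
    refine ⟨_, ⟨Z, hZ, rfl⟩, ?_, fun f hf => ?_⟩
    · by_cases h : e ∈ A <;> simp [SignVec.reorient, h, hZe]
    · have := hZf f (fun h => hf ((key f).2 h))
      by_cases h : f ∈ A <;> by_cases h0 : X f = 0 <;>
        simp_all [SignVec.reorient, SignVec.comp]

/-- `M'` is an extension of `M` by one new pseudohyperplane `none`: the restriction of `M'` to the
old elements is `M`, the new element is not a loop, and the rank does not change. -/
def IsOneElementExtension (M : OrientedMatroid E) (M' : OrientedMatroid (Option E)) : Prop :=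
  M'.restrict Function.Embedding.some = M ∧ ¬ M'.IsLoop none ∧ ∃ r, M.HasRank r ∧ M'.HasRank r

/-- The new pseudohyperplane `none` of `M'` intersects the (closed) cell of the tope `T`: some
covector that is zero at `none` restricts to a nonzero face of `T` on the old elements. -/
def NewElementMeets (M' : OrientedMatroid (Option E)) (T : E → SignType) : Prop :=
  ∃ X ∈ M'.covectors, X none = 0 ∧ (∃ e, X (some e) ≠ 0) ∧ Conf (fun e => X (some e)) T

/-- `M` has rank 4 on 12 elements, `U` and `T` are topes of `M` (and `U` has no zero entry, i.e.
`M` has no loops), and no extending pseudoplane intersects `U` and `T` simultaneously. -/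
structure IsRichterGebert (M : OrientedMatroid (Fin 12)) (U T : Fin 12 → SignType) : Prop where
  rank_four : M.HasRank 4
  tope_left : M.IsTope U
  tope_right : M.IsTope T
  full_support : ∀ e, U e ≠ 0
  not_both : ¬ ∃ M' : OrientedMatroid (Option (Fin 12)),
    M.IsOneElementExtension M' ∧ M'.NewElementMeets U ∧ M'.NewElementMeets T

end OrientedMatroid

/-- The pairs `(i, j)` with `i < j` in an `n`-element index set. -/
abbrev Pairs (n : ℕ) : Type := {q : Fin n × Fin n // q.1 < q.2}

/-- The covectors of the braid oriented matroid, the oriented matroid of the vector configuration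
`e_j - e_i` for `i < j`. -/
def braidCovectors (n : ℕ) : Set (Pairs n → SignType) :=
  {X | ∃ u : Fin n → ℝ, ∀ q : Pairs n, X q = SignType.sign (u q.1.2 - u q.1.1)}

/-- `S` is a sweep oriented matroid: there is a strong map from the braid oriented matroid
to `S`, i.e. all covectors of `S` are covectors of the braid oriented matroid. -/
def OrientedMatroid.IsSweep {n : ℕ} (S : OrientedMatroid (Pairs n)) : Prop :=
  S.covectors ⊆ braidCovectors n

/-- `p` is the surjection from the index set onto `{1, …, l}` of the ordered partition with `l`
parts that corresponds to `X`. -/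
def IsPartitionOf {n : ℕ} (X : Pairs n → SignType) (l : ℕ) (p : Fin n → ℕ) : Prop :=
  Set.range p = Set.Icc 1 l ∧
    ∀ q : Pairs n, X q = SignType.sign ((p q.1.2 : ℤ) - (p q.1.1 : ℤ))

/-- The sign vector `X^k` on the elements `i` and the pairs `(i, j)`, for `k ≥ 1`, where `p` is the
surjection of the ordered partition of `X`. The entry at `i` is zero exactly if `k` is even and
`p i = k / 2`. -/
def sweepLift {n : ℕ} (X : Pairs n → SignType) (p : Fin n → ℕ) (k : ℕ) :
    Fin n ⊕ Pairs n → SignType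
  | Sum.inl i => if p i ≤ (k - 1) / 2 then -1 else if k / 2 < p i then 1 else 0
  | Sum.inr q => X q

namespace OrientedMatroid

variable {n : ℕ}

/-- The covectors of the big oriented matroid of a sweep oriented matroid. -/
def bigCovectors (S : OrientedMatroid (Pairs n)) : Set (Fin n ⊕ Pairs n → SignType) :=
  {Z | ∃ X ∈ S.covectors, ∃ l p k, IsPartitionOf X l p ∧ 1 ≤ k ∧ k ≤ 2 * l + 1 ∧
    Z = sweepLift X p k}

/-- The covectors of the little oriented matroid of a sweep oriented matroid: delete all pairs
from the big oriented matroid. -/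
def littleCovectors (S : OrientedMatroid (Pairs n)) : Set (Fin n → SignType) :=
  {Y | ∃ Z ∈ S.bigCovectors, Y = fun i => Z (Sum.inl i)}

/-- `L` is the little oriented matroid of some sweep oriented matroid. Equivalently, `L` extends
to a big oriented matroid, i.e. it is the restriction of one. -/
def IsLittle (L : OrientedMatroid (Fin n)) : Prop :=
  ∃ S : OrientedMatroid (Pairs n), S.IsSweep ∧ L.covectors = S.littleCovectors

end OrientedMatroid

/-! Part (2). The covectors of the big oriented matroid are the sign patterns of real vectors `u`
together with all their differences `u j - u i`, where `pairSign u` runs over the covectors of the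
sweep oriented matroid (`bigCovectors_eq`). They satisfy the covector axioms
(`OrientedMatroid.big`); the delicate axiom is elimination of an element of the index set
(`exists_elim_elem`). Suppose now that the reorientation of `M` that makes `U` positive is little.
Choose a minimal nonzero covector `Y` below `T`. Since the rank is at least four, `Y` vanishes on
two non-parallel elements `i`, `j` (`exists_not_parallel`). The pair of `i` and `j`, taken from the
big oriented matroid, is a new element of `M`. It is not a loop because `i` and `j` are not
parallel, and it does not raise the rank because it vanishes wherever `i` and `j` do
(`hasFlag_restrict_some_iff`). It vanishes on `Y`, hence meets `T`, and it vanishes on the constant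
vector `1`, which gives `U`. So some extension meets both topes, which the definition of a
Richter-Gebert triple forbids.

Part (1). The example is an explicit uniform oriented matroid, stored as the set of its topes. A
nonzero sign vector counts as a covector if all its full refinements are topes; finitely many
checks, collected in `IsUniform`, imply the axioms and rank four. Elimination comes from walking
from one cell to another across walls that separate them (`exists_flip`, `elim_of_same_zeros`). For
a one-element extension, record at which vertices (covectors with three zeros) the new element is
positive. These truth values obey three kinds of clauses: opposite vertices are not both positive
(`not_isPos_neg`), elimination relates three vertices on a line (`isPos_of_line`), and not all
corners of a simplicial cone vanish (`exists_isPos`). Meeting a simplicial tope says that its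
corners are not strictly on one side (`not_same_side`). A resolution refutation, whose steps are
sound by `refutes_eq_false`, shows that these clauses are contradictory for two particular topes.

Part (3) is the reorientation of the example, since reorientation preserves rank. -/

open SignVec

/-! ### The big oriented matroid of a sweep oriented matroid -/

section SweepBig

variable {n : ℕ}

/-- The signs of the differences of the coordinates of `u`. -/
noncomputable def pairSign (u : Fin n → ℝ) : Pairs n → SignType :=
  fun q => SignType.sign (u q.1.2 - u q.1.1)

/-- The signs of the coordinates of `u` and of their differences. -/
noncomputable def liftSign (u : Fin n → ℝ) : Fin n ⊕ Pairs n → SignType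
  | Sum.inl i => SignType.sign (u i)
  | Sum.inr q => pairSign u q

lemma sign_cases (x : ℝ) : (x < 0 ∧ SignType.sign x = -1) ∨ (x = 0 ∧ SignType.sign x = 0) ∨
    (0 < x ∧ SignType.sign x = 1) := by
  rcases lt_trichotomy x 0 with h | h | h
  · exact Or.inl ⟨h, sign_neg h⟩
  · exact Or.inr (Or.inl ⟨h, by simp [h]⟩)
  · exact Or.inr (Or.inr ⟨h, sign_pos h⟩)

/-- On the pair `i`, `j`, the function `w` is ordered like the lexicographic combination of
`u` and `v`. -/
def CompatAt (u v w : Fin n → ℝ) (i j : Fin n) : Prop :=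
  (u i < u j → w i < w j) ∧ (u j < u i → w j < w i) ∧
    (u i = u j → (v i < v j → w i < w j) ∧ (v j < v i → w j < w i) ∧ (v i = v j → w i = w j))

/-- The pair `i`, `j` is ordered in opposite ways by `u` and `v`. -/
def OppositeAt (u v : Fin n → ℝ) (i j : Fin n) : Prop :=
  (u i < u j ∧ v j < v i) ∨ (u j < u i ∧ v i < v j)

lemma CompatAt.symm {u v w : Fin n → ℝ} {i j : Fin n} (h : CompatAt u v w i j) :
    CompatAt u v w j i :=
  ⟨h.2.1, h.1, fun e => ⟨(h.2.2 e.symm).2.1, (h.2.2 e.symm).1,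
    fun e' => ((h.2.2 e.symm).2.2 e'.symm).symm⟩⟩

lemma OppositeAt.symm {u v : Fin n → ℝ} {i j : Fin n} (h : OppositeAt u v i j) :
    OppositeAt u v j i := Or.symm h

lemma separates_pairSign_iff {u v : Fin n → ℝ} {q : Pairs n} :
    Separates (pairSign u) (pairSign v) q ↔ OppositeAt u v q.1.1 q.1.2 := by
  unfold Separates OppositeAt pairSign
  rcases sign_cases (u q.1.2 - u q.1.1) with ⟨h, e⟩ | ⟨h, e⟩ | ⟨h, e⟩ <;>
  rcases sign_cases (v q.1.2 - v q.1.1) with ⟨h', e'⟩ | ⟨h', e'⟩ | ⟨h', e'⟩ <;>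
  rw [e, e'] <;> simp <;> grind

lemma compatAt_of_pair {u v w : Fin n → ℝ} {q : Pairs n}
    (h : pairSign w q = comp (pairSign u) (pairSign v) q) :
    CompatAt u v w q.1.1 q.1.2 := by
  unfold comp pairSign at h
  unfold CompatAt
  rcases sign_cases (u q.1.2 - u q.1.1) with ⟨h1, e⟩ | ⟨h1, e⟩ | ⟨h1, e⟩ <;>
  rcases sign_cases (v q.1.2 - v q.1.1) with ⟨h2, e'⟩ | ⟨h2, e'⟩ | ⟨h2, e'⟩ <;>
  rcases sign_cases (w q.1.2 - w q.1.1) with ⟨h3, e''⟩ | ⟨h3, e''⟩ | ⟨h3, e''⟩ <;>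
  rw [e, e', e''] at h <;> first | (exfalso; revert h; decide) | grind

/-- If `w` agrees with the composition on all pairs that satisfy a symmetric condition, it is
compatible there. -/
lemma compatAt_of_forall {u v w : Fin n → ℝ} (P : Fin n → Fin n → Prop)
    (hP : ∀ i j, P i j → P j i)
    (h : ∀ q : Pairs n, P q.1.1 q.1.2 → pairSign w q = comp (pairSign u) (pairSign v) q)
    {i j : Fin n} (hij : P i j) : CompatAt u v w i j := by
  rcases lt_trichotomy i j with hlt | rfl | hlt
  · exact compatAt_of_pair (q := ⟨(i, j), hlt⟩) (h ⟨(i, j), hlt⟩ hij)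
  · simp [CompatAt]
  · exact (compatAt_of_pair (q := ⟨(j, i), hlt⟩) (h ⟨(j, i), hlt⟩ (hP _ _ hij))).symm

/-- A threshold that realizes prescribed signs which are monotone in `u`. -/
lemma exists_threshold (u : Fin n → ℝ) (c : Fin n → SignType) (D : Fin n → Prop)
    (hlt : ∀ i j, D i → D j → c i < c j → u i < u j)
    (heq : ∀ i j, D i → D j → c i = 0 → c j = 0 → u i = u j) :
    ∃ t, ∀ i, D i → SignType.sign (u i - t) = c i := by
  classical
  -- A prescribed zero forces the threshold to be the value there. Without zeros, any number between
  -- the values with sign `-` and those with sign `+` works.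
  by_cases h0 : ∃ o, D o ∧ c o = 0
  · obtain ⟨o, hD, ho⟩ := h0
    refine ⟨u o, fun i hi => ?_⟩
    rcases hc : c i with _ | _ | _
    · have := heq i o hi hD (by simpa using hc) ho
      simp [this]
    · have := hlt i o hi hD (by rw [hc, ho]; decide)
      exact sign_neg (by linarith)
    · have := hlt o i hD hi (by rw [hc, ho]; decide)
      exact sign_pos (by linarith)
  · push Not at h0
    obtain ⟨t, ht1, ht2⟩ := Set.Finite.exists_between'
      (s := u '' {i | D i ∧ c i = -1}) (t := u '' {i | D i ∧ c i = 1})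
      (Set.toFinite _) (Set.toFinite _) (by
        rintro _ ⟨i, hi, rfl⟩ _ ⟨j, hj, rfl⟩
        exact hlt i j hi.1 hj.1 (by rw [hi.2, hj.2]; decide))
    refine ⟨t, fun i hi => ?_⟩
    rcases hc : c i with _ | _ | _
    · exact absurd hc (h0 i hi)
    · have := ht1 (u i) ⟨i, ⟨hi, hc⟩, rfl⟩
      exact sign_neg (by linarith)
    · have := ht2 (u i) ⟨i, ⟨hi, hc⟩, rfl⟩
      exact sign_pos (by linarith)

lemma pairSign_sub_const (u : Fin n → ℝ) (t : ℝ) : pairSign (fun i => u i - t) = pairSign u := by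
  funext q
  simp [pairSign]

lemma SignVec.not_separates_left {E : Type*} {X Y Z : E → SignType} {f : E}
    (h : ¬ Separates X Y f) (hZ : Z f = comp X Y f) :
    ¬ Separates X Z f ∧ comp X Z f = comp X Y f := by
  simp only [Separates, comp] at *
  rw [hZ]
  clear hZ
  generalize X f = x at *
  generalize Y f = y at *
  revert x y
  decide

lemma SignVec.not_separates_right {E : Type*} {X Y Z : E → SignType} {f : E}
    (h : ¬ Separates X Y f) (hZ : Z f = comp X Y f) :
    ¬ Separates Z Y f ∧ comp Z Y f = comp X Y f := by
  simp only [Separates, comp] at *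
  rw [hZ]
  clear hZ
  generalize X f = x at *
  generalize Y f = y at *
  revert x y
  decide

/-- A common threshold lemma: pair signs given by `w₀`, prescribed entries given by the
composition of `u` and `v`. -/
lemma exists_liftSign_of_compatAt {u v w₀ : Fin n → ℝ} (D : Fin n → Prop)
    (hD : ∀ i, D i → ¬ Separates (liftSign u) (liftSign v) (Sum.inl i))
    (hc : ∀ i j, D i → D j → ¬ OppositeAt u v i j → CompatAt u v w₀ i j) :
    ∃ w, pairSign w = pairSign w₀ ∧
      ∀ i, D i → liftSign w (Sum.inl i) = comp (liftSign u) (liftSign v) (Sum.inl i) := by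
  -- At an element that is not separated, `u` and `v` lie weakly on the same side of zero. Two such
  -- elements with different composed signs are therefore never ordered oppositely by `u` and `v`,
  -- so `hc` applies.
  have key : ∀ i j, D i → D j →
      (comp (liftSign u) (liftSign v) (Sum.inl i) < comp (liftSign u) (liftSign v) (Sum.inl j) →
        w₀ i < w₀ j) ∧
      (comp (liftSign u) (liftSign v) (Sum.inl i) = 0 →
        comp (liftSign u) (liftSign v) (Sum.inl j) = 0 → w₀ i = w₀ j) := by
    intro i j hi hj
    have hi' := hD i hi
    have hj' := hD j hj
    have hcij := hc i j hi hj
    unfold CompatAt OppositeAt at hcij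
    have ec : ∀ k, comp (liftSign u) (liftSign v) (Sum.inl k) =
        if SignType.sign (u k) = 0 then SignType.sign (v k) else SignType.sign (u k) :=
      fun _ => rfl
    rw [ec, ec]
    replace hi' : ¬ (SignType.sign (u i) ≠ 0 ∧ SignType.sign (v i) = -SignType.sign (u i)) := hi'
    replace hj' : ¬ (SignType.sign (u j) ≠ 0 ∧ SignType.sign (v j) = -SignType.sign (u j)) := hj'
    clear ec hi hj hc hD
    rcases sign_cases (u i) with ⟨h1, e1⟩ | ⟨h1, e1⟩ | ⟨h1, e1⟩ <;>
    rcases sign_cases (v i) with ⟨h2, e2⟩ | ⟨h2, e2⟩ | ⟨h2, e2⟩ <;>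
    rw [e1, e2] at hi' <;> rw [e1, e2] <;>
    first
    | (exfalso; revert hi'; decide)
    | (rcases sign_cases (u j) with ⟨h3, e3⟩ | ⟨h3, e3⟩ | ⟨h3, e3⟩ <;>
       rcases sign_cases (v j) with ⟨h4, e4⟩ | ⟨h4, e4⟩ | ⟨h4, e4⟩ <;>
       rw [e3, e4] at hj' <;> rw [e3, e4] <;>
       first
       | (exfalso; revert hj'; decide)
       | (refine ⟨fun hx => ?_, fun hx hy => ?_⟩ <;>
          first
          | (exfalso; revert hx; decide)
          | (exfalso; revert hy; decide)
          | grind))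
  obtain ⟨t, ht⟩ := exists_threshold w₀ (fun i => comp (liftSign u) (liftSign v) (Sum.inl i)) D
    (fun i j hi hj => (key i j hi hj).1) (fun i j hi hj => (key i j hi hj).2)
  exact ⟨fun i => w₀ i - t, pairSign_sub_const _ _, ht⟩

end SweepBig

section SweepBig

variable {n : ℕ}

/-- The vector `w₀` orders the indices lexicographically by `(u, v)`, and the composed sign at `i`
compares `(u i, v i)` with `(0, 0)` in the same order. Hence a threshold among the values of `w₀`
realizes all composed signs at once. -/
lemma exists_comp_liftSign {S : OrientedMatroid (Pairs n)} (hS : S.IsSweep) {u v : Fin n → ℝ}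
    (hu : pairSign u ∈ S.covectors) (hv : pairSign v ∈ S.covectors) :
    ∃ w, pairSign w ∈ S.covectors ∧ liftSign w = comp (liftSign u) (liftSign v) := by
  have hc := S.comp_mem _ hu _ hv
  obtain ⟨w₀, hw₀⟩ := hS hc
  have hw₀' : pairSign w₀ = comp (pairSign u) (pairSign v) := (funext hw₀).symm
  have hcompat : ∀ i j, CompatAt u v w₀ i j := fun i j =>
    compatAt_of_forall (fun _ _ => True) (fun _ _ h => h) (fun q _ => congrFun hw₀' q) trivial
  have key : ∀ i j,
      (comp (liftSign u) (liftSign v) (Sum.inl i) < comp (liftSign u) (liftSign v) (Sum.inl j) →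
        w₀ i < w₀ j) ∧
      (comp (liftSign u) (liftSign v) (Sum.inl i) = 0 →
        comp (liftSign u) (liftSign v) (Sum.inl j) = 0 → w₀ i = w₀ j) := by
    intro i j
    have hcij := hcompat i j
    unfold CompatAt at hcij
    have ec : ∀ k, comp (liftSign u) (liftSign v) (Sum.inl k) =
        if SignType.sign (u k) = 0 then SignType.sign (v k) else SignType.sign (u k) :=
      fun _ => rfl
    rw [ec, ec]
    clear ec hcompat hw₀' hw₀
    rcases sign_cases (u i) with ⟨h1, e1⟩ | ⟨h1, e1⟩ | ⟨h1, e1⟩ <;>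
    rcases sign_cases (u j) with ⟨h3, e3⟩ | ⟨h3, e3⟩ | ⟨h3, e3⟩ <;>
    rw [e1, e3] <;>
    rcases sign_cases (v i) with ⟨h2, e2⟩ | ⟨h2, e2⟩ | ⟨h2, e2⟩ <;>
    rcases sign_cases (v j) with ⟨h4, e4⟩ | ⟨h4, e4⟩ | ⟨h4, e4⟩ <;>
    rw [e2, e4] <;>
    (refine ⟨fun hx => ?_, fun hx hy => ?_⟩ <;>
          first
          | (exfalso; revert hx; decide)
          | (exfalso; revert hy; decide)
          | grind)
  obtain ⟨t, ht⟩ := exists_threshold w₀ (fun i => comp (liftSign u) (liftSign v) (Sum.inl i))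
    (fun _ => True) (fun i j _ _ => (key i j).1) (fun i j _ _ => (key i j).2)
  have hp := pairSign_sub_const w₀ t
  refine ⟨fun i => w₀ i - t, by rw [hp, hw₀']; exact hc, ?_⟩
  funext f
  rcases f with i | q
  · exact ht i trivial
  · exact congrFun (hp.trans hw₀') q

/-- Elimination of a pair in the big oriented matroid. -/
lemma exists_elim_pair {S : OrientedMatroid (Pairs n)} (hS : S.IsSweep) {u v : Fin n → ℝ}
    (hu : pairSign u ∈ S.covectors) (hv : pairSign v ∈ S.covectors) {q : Pairs n}
    (hq : Separates (liftSign u) (liftSign v) (Sum.inr q)) :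
    ∃ w, pairSign w ∈ S.covectors ∧ liftSign w (Sum.inr q) = 0 ∧
      ∀ f, ¬ Separates (liftSign u) (liftSign v) f →
        liftSign w f = comp (liftSign u) (liftSign v) f := by
  obtain ⟨Z, hZ, hZq, hZf⟩ := S.elim _ hu _ hv q hq
  obtain ⟨w₀, hw₀⟩ := hS hZ
  obtain rfl : Z = pairSign w₀ := funext hw₀
  obtain ⟨w, hw, hwi⟩ := exists_liftSign_of_compatAt (u := u) (v := v) (w₀ := w₀)
    (fun i => ¬ Separates (liftSign u) (liftSign v) (Sum.inl i)) (fun _ h => h)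
    (fun i j _ _ hij => compatAt_of_forall (fun i j => ¬ OppositeAt u v i j)
      (fun i j h h' => h h'.symm)
      (fun p hp => hZf p (fun h => hp (separates_pairSign_iff.1 h))) hij)
  refine ⟨w, hw ▸ hZ, ?_, ?_⟩
  · show pairSign w q = 0
    rw [hw, hZq]
  · rintro (i | p) hf
    · exact hwi i hf
    · show pairSign w p = _
      rw [hw]
      exact hZf p hf

open Classical in
/-- Elimination of an element of the index set in the big oriented matroid. -/
lemma exists_elim_elem {S : OrientedMatroid (Pairs n)} (hS : S.IsSweep) (i : Fin n) (N : ℕ) :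
    ∀ u v : Fin n → ℝ, pairSign u ∈ S.covectors → pairSign v ∈ S.covectors →
    (Finset.univ.filter fun q => Separates (pairSign u) (pairSign v) q).card < N →
    Separates (liftSign u) (liftSign v) (Sum.inl i) →
    ∃ w, pairSign w ∈ S.covectors ∧ liftSign w (Sum.inl i) = 0 ∧
      ∀ f, ¬ Separates (liftSign u) (liftSign v) f →
        liftSign w f = comp (liftSign u) (liftSign v) f := by
  induction N with
  | zero => intro u v _ _ h; exact absurd h (Nat.not_lt_zero _)
  | succ N ih =>
    intro u v hu hv hcard hi
    -- An index `j` that is not separated but is ordered oppositely to `i` is the only obstruction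
    -- to the direct construction below. It is handled by eliminating the pair of `i` and `j` first,
    -- which lowers the number of separated pairs.
    by_cases h : ∃ j, ¬ Separates (liftSign u) (liftSign v) (Sum.inl j) ∧ OppositeAt u v i j
    · obtain ⟨j, hj, hij⟩ := h
      obtain ⟨q, hq, hqij⟩ : ∃ q : Pairs n, Separates (pairSign u) (pairSign v) q ∧
          ∀ w, pairSign w q = 0 → w i = w j := by
        rcases lt_trichotomy i j with hlt | rfl | hlt
        · refine ⟨⟨(i, j), hlt⟩, separates_pairSign_iff.2 hij, fun w hw => ?_⟩
          have := sign_eq_zero_iff.1 hw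
          simp only at this
          linarith
        · rcases hij with hij | hij <;> exact absurd hij.1 (lt_irrefl _)
        · refine ⟨⟨(j, i), hlt⟩, separates_pairSign_iff.2 hij.symm, fun w hw => ?_⟩
          have := sign_eq_zero_iff.1 hw
          simp only at this
          linarith
      obtain ⟨w, hw, hwq, hwf⟩ := exists_elim_pair hS hu hv (q := q) hq
      have hwij : w i = w j := hqij w hwq
      by_cases hw0 : liftSign w (Sum.inl i) = 0
      · exact ⟨w, hw, hw0, hwf⟩
      -- The signs of `u i` and `v i` are opposite, so the nonzero sign of `w i` is opposite to one
      -- of them. Elimination continues between `w` and that one; entries not separated before stay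
      -- so and keep their composed value.
      by_cases hwi : Separates (liftSign u) (liftSign w) (Sum.inl i)
      · obtain ⟨w', hw', hw'i, hw'f⟩ := ih u w hu hw (by
          refine lt_of_lt_of_le (Finset.card_lt_card ?_) (Nat.lt_succ_iff.1 hcard)
          refine ⟨fun p hp => ?_, fun hsub => ?_⟩
          · simp only [Finset.mem_filter, Finset.mem_univ, true_and] at hp ⊢
            by_contra hp'
            exact (not_separates_left (X := pairSign u) (Z := pairSign w) hp'
              (hwf (Sum.inr p) hp')).1 hp
          · have := hsub (Finset.mem_filter.2 ⟨Finset.mem_univ q, hq⟩)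
            simp only [Finset.mem_filter, Finset.mem_univ, true_and] at this
            have h0 : pairSign w q = 0 := hwq
            obtain ⟨h1, h2⟩ := this
            rw [h0] at h2
            exact h1 (by simpa using h2.symm)) hwi
        refine ⟨w', hw', hw'i, fun f hf => ?_⟩
        obtain ⟨h1, h2⟩ := not_separates_left hf (hwf f hf)
        rw [hw'f f h1, h2]
      · have hwi' : Separates (liftSign w) (liftSign v) (Sum.inl i) := by
          unfold Separates at *
          generalize liftSign u (Sum.inl i) = x at *
          generalize liftSign v (Sum.inl i) = y at *
          generalize liftSign w (Sum.inl i) = z at *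
          clear hwq hwf hwij hj hij hqij
          revert x y z
          decide
        obtain ⟨w', hw', hw'i, hw'f⟩ := ih w v hw hv (by
          refine lt_of_lt_of_le (Finset.card_lt_card ?_) (Nat.lt_succ_iff.1 hcard)
          refine ⟨fun p hp => ?_, fun hsub => ?_⟩
          · simp only [Finset.mem_filter, Finset.mem_univ, true_and] at hp ⊢
            by_contra hp'
            exact (not_separates_right (X := pairSign u) (Z := pairSign w) hp'
              (hwf (Sum.inr p) hp')).1 hp
          · have := hsub (Finset.mem_filter.2 ⟨Finset.mem_univ q, hq⟩)
            simp only [Finset.mem_filter, Finset.mem_univ, true_and] at this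
            exact this.1 hwq) hwi'
        refine ⟨w', hw', hw'i, fun f hf => ?_⟩
        obtain ⟨h1, h2⟩ := not_separates_right hf (hwf f hf)
        rw [hw'f f h1, h2]
    -- Without an obstruction, the composition itself is used on the pairs, translated so that the
    -- value at `i` becomes zero.
    · push Not at h
      have hc := S.comp_mem _ hu _ hv
      obtain ⟨w₀, hw₀⟩ := hS hc
      have hw₀' : pairSign w₀ = comp (pairSign u) (pairSign v) := (funext hw₀).symm
      have hcompat : ∀ i j, CompatAt u v w₀ i j := fun i j =>
        compatAt_of_forall (fun _ _ => True) (fun _ _ h => h) (fun q _ => congrFun hw₀' q) trivial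
      have hp := pairSign_sub_const w₀ (w₀ i)
      refine ⟨fun j => w₀ j - w₀ i, by rw [hp, hw₀']; exact hc, by simp [liftSign], ?_⟩
      rintro (j | p) hf
      · have h1 := h j hf
        have h2 := hcompat i j
        have ec : ∀ k, comp (liftSign u) (liftSign v) (Sum.inl k) =
            if SignType.sign (u k) = 0 then SignType.sign (v k) else SignType.sign (u k) :=
          fun _ => rfl
        rw [ec]
        show SignType.sign (w₀ j - w₀ i) = _
        replace hi : SignType.sign (u i) ≠ 0 ∧ SignType.sign (v i) = -SignType.sign (u i) := hi
        replace hf : ¬ (SignType.sign (u j) ≠ 0 ∧ SignType.sign (v j) = -SignType.sign (u j)) := hf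
        unfold CompatAt at h2
        unfold OppositeAt at h1
        clear ec hcompat h hp hw₀ hw₀'
        rcases sign_cases (u i) with ⟨h3, e3⟩ | ⟨h3, e3⟩ | ⟨h3, e3⟩ <;>
        rcases sign_cases (v i) with ⟨h4, e4⟩ | ⟨h4, e4⟩ | ⟨h4, e4⟩ <;>
        rw [e3, e4] at hi <;>
        first
        | (exfalso; revert hi; decide)
        | (rcases sign_cases (u j) with ⟨h5, e5⟩ | ⟨h5, e5⟩ | ⟨h5, e5⟩ <;>
           rcases sign_cases (v j) with ⟨h6, e6⟩ | ⟨h6, e6⟩ | ⟨h6, e6⟩ <;>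
           rw [e5, e6] at hf <;> rw [e5, e6] <;>
           first
           | (exfalso; revert hf; decide)
           | (rcases sign_cases (w₀ j - w₀ i) with ⟨h7, e7⟩ | ⟨h7, e7⟩ | ⟨h7, e7⟩ <;> rw [e7] <;>
              first
              | rfl
              | (exfalso; grind)))
      · exact congrFun (hp.trans hw₀') p

/-- The big oriented matroid of a sweep oriented matroid. -/
noncomputable def OrientedMatroid.big (S : OrientedMatroid (Pairs n)) (hS : S.IsSweep) :
    OrientedMatroid (Fin n ⊕ Pairs n) where
  covectors := {Z | ∃ u, pairSign u ∈ S.covectors ∧ Z = liftSign u}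
  zero_mem := by
    have h : pairSign (fun _ : Fin n => 0) = fun _ => 0 := by funext q; simp [pairSign]
    refine ⟨fun _ => 0, h ▸ S.zero_mem, ?_⟩
    funext f
    rcases f with i | q
    · simp [liftSign]
    · exact (congrFun h q).symm
  neg_mem := by
    rintro _ ⟨u, hu, rfl⟩
    have h : pairSign (fun i => -u i) = fun q => -pairSign u q := by
      funext q
      simp only [pairSign]
      rw [← Left.sign_neg]
      congr 1
      ring
    refine ⟨fun i => -u i, h ▸ S.neg_mem _ hu, ?_⟩
    funext f
    rcases f with i | q
    · exact (Left.sign_neg _).symm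
    · exact (congrFun h q).symm
  comp_mem := by
    rintro _ ⟨u, hu, rfl⟩ _ ⟨v, hv, rfl⟩
    obtain ⟨w, hw, hwf⟩ := exists_comp_liftSign hS hu hv
    exact ⟨w, hw, hwf.symm⟩
  elim := by
    rintro _ ⟨u, hu, rfl⟩ _ ⟨v, hv, rfl⟩ (i | q) he
    · obtain ⟨w, hw, h⟩ := exists_elim_elem hS i _ u v hu hv (Nat.lt_succ_self _) he
      exact ⟨_, ⟨w, hw, rfl⟩, h⟩
    · obtain ⟨w, hw, h⟩ := exists_elim_pair hS hu hv he
      exact ⟨_, ⟨w, hw, rfl⟩, h⟩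

/-- Every real function on the index set induces an ordered partition. -/
lemma exists_isPartitionOf (u : Fin n → ℝ) :
    ∃ l p k, IsPartitionOf (pairSign u) l p ∧ 1 ≤ k ∧ k ≤ 2 * l + 1 ∧
      liftSign u = sweepLift (pairSign u) p k := by
  classical
  set s : Finset ℝ := Finset.univ.image u with hs
  have hmem : ∀ i, u i ∈ s := fun i => Finset.mem_image_of_mem _ (Finset.mem_univ i)
  have hmono : ∀ x ∈ s, ∀ y ∈ s, x < y → (s.filter (· ≤ x)).card < (s.filter (· ≤ y)).card := by
    intro x _ y hy hxy
    refine Finset.card_lt_card ⟨fun z hz => ?_, fun hsub => ?_⟩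
    · simp only [Finset.mem_filter] at hz ⊢
      exact ⟨hz.1, hz.2.trans hxy.le⟩
    · have := hsub (Finset.mem_filter.2 ⟨hy, le_refl y⟩)
      exact absurd (Finset.mem_filter.1 this).2 (not_le.2 hxy)
  set p : Fin n → ℕ := fun i => (s.filter (· ≤ u i)).card with hp
  have hplt : ∀ i j, u i < u j → p i < p j := fun i j h => hmono _ (hmem i) _ (hmem j) h
  have hpeq : ∀ i j, u i = u j → p i = p j := fun i j h => by simp only [hp, h]
  have hrange : Set.range p = Set.Icc 1 s.card := by
    have himg : s.image (fun x => (s.filter (· ≤ x)).card) = Finset.Icc 1 s.card := by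
      refine Finset.eq_of_subset_of_card_le ?_ ?_
      · intro m hm
        obtain ⟨x, hx, rfl⟩ := Finset.mem_image.1 hm
        exact Finset.mem_Icc.2 ⟨Finset.card_pos.2 ⟨x, Finset.mem_filter.2 ⟨hx, le_refl _⟩⟩,
          Finset.card_le_card (Finset.filter_subset _ _)⟩
      · have hinj : Set.InjOn (fun x => (s.filter (· ≤ x)).card) s := by
          intro x hx y hy hxy
          rcases lt_trichotomy x y with h | h | h
          · exact absurd hxy (hmono x hx y hy h).ne
          · exact h
          · exact absurd hxy (hmono y hy x hx h).ne'
        rw [Finset.card_image_of_injOn hinj, Nat.card_Icc, Nat.add_sub_cancel]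
    ext m
    rw [← Finset.coe_Icc, ← himg]
    simp [hs, hp]
  set a := (s.filter (· ≤ 0)).card
  set b := (s.filter (· < 0)).card
  have hba : b ≤ a := Finset.card_le_card (fun x hx => by
    simp only [Finset.mem_filter] at hx ⊢
    exact ⟨hx.1, hx.2.le⟩)
  have hab : a ≤ b + 1 := by
    have : s.filter (· ≤ 0) ⊆ insert 0 (s.filter (· < 0)) := fun x hx => by
      simp only [Finset.mem_filter, Finset.mem_insert] at hx ⊢
      rcases hx.2.lt_or_eq with h | h
      · exact Or.inr ⟨hx.1, h⟩
      · exact Or.inl h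
    exact (Finset.card_le_card this).trans (Finset.card_insert_le _ _)
  have hal : a ≤ s.card := Finset.card_le_card (Finset.filter_subset _ _)
  have hneg : ∀ i, u i < 0 → p i ≤ b := fun i hi => Finset.card_le_card (fun x hx => by
    simp only [Finset.mem_filter] at hx ⊢
    exact ⟨hx.1, hx.2.trans_lt hi⟩)
  have hzero : ∀ i, u i = 0 → p i = a ∧ b < a := fun i hi => by
    refine ⟨by simp only [hp, hi]; rfl, Finset.card_lt_card ⟨fun x hx => ?_, fun hsub => ?_⟩⟩
    · simp only [Finset.mem_filter] at hx ⊢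
      exact ⟨hx.1, hx.2.le⟩
    · have := hsub (Finset.mem_filter.2 ⟨hi ▸ hmem i, le_refl 0⟩)
      exact lt_irrefl _ (Finset.mem_filter.1 this).2
  have hpos : ∀ i, 0 < u i → a < p i := fun i hi => by
    refine Finset.card_lt_card ⟨fun x hx => ?_, fun hsub => ?_⟩
    · simp only [Finset.mem_filter] at hx ⊢
      exact ⟨hx.1, hx.2.trans hi.le⟩
    · have := hsub (Finset.mem_filter.2 ⟨hmem i, le_refl (u i)⟩)
      exact absurd (Finset.mem_filter.1 this).2 (not_le.2 hi)
  -- Here `a` and `b` count the distinct values that are at most zero and below zero. If zero is a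
  -- value, then `a = b + 1` and `k = 2 * a` is even; otherwise `a = b` and `k` is odd, a position
  -- between two blocks.
  refine ⟨s.card, p, a + b + 1, ⟨hrange, fun q => ?_⟩, by omega, by omega, ?_⟩
  · simp only [pairSign]
    rcases lt_trichotomy (u q.1.1) (u q.1.2) with h | h | h
    · have := hplt _ _ h
      rw [sign_pos (by linarith), sign_pos (by omega)]
    · have := hpeq _ _ h
      rw [h, this]
      simp
    · have := hplt _ _ h
      rw [sign_neg (by linarith), sign_neg (by omega)]
  · funext f
    rcases f with i | q
    · simp only [liftSign, sweepLift]
      rcases lt_trichotomy (u i) 0 with h | h | h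
      · have := hneg i h
        rw [sign_neg h, if_pos (by omega)]
      · obtain ⟨h1, h2⟩ := hzero i h
        rw [h, sign_zero, if_neg (by omega), if_neg (by omega)]
      · have := hpos i h
        rw [sign_pos h, if_neg (by omega), if_pos (by omega)]
    · rfl

lemma bigCovectors_eq {S : OrientedMatroid (Pairs n)} (hS : S.IsSweep) :
    S.bigCovectors = (S.big hS).covectors := by
  ext Z
  constructor
  · rintro ⟨X, hX, l, p, k, hp, hk1, -, rfl⟩
    -- After doubling, an even `k` hits the block `k / 2` and an odd `k` falls strictly between
    -- blocks.
    have h : pairSign (fun i => (2 * p i : ℝ) - k) = X := by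
      funext q
      rw [hp.2 q]
      simp only [pairSign]
      rcases lt_trichotomy (p q.1.1) (p q.1.2) with h | h | h
      · have h' : (p q.1.1 : ℝ) < p q.1.2 := by exact_mod_cast h
        rw [sign_pos (by linarith), sign_pos (by omega)]
      · rw [h]
        simp
      · have h' : (p q.1.2 : ℝ) < p q.1.1 := by exact_mod_cast h
        rw [sign_neg (by linarith), sign_neg (by omega)]
    refine ⟨fun i => (2 * p i : ℝ) - k, h ▸ hX, ?_⟩
    funext f
    rcases f with i | q
    · simp only [liftSign, sweepLift]
      rcases lt_trichotomy (2 * p i) k with h | h | h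
      · have h' : (2 * p i : ℝ) < k := by exact_mod_cast h
        rw [sign_neg (by linarith), if_pos (by omega)]
      · have h' : (2 * p i : ℝ) = k := by exact_mod_cast h
        rw [h', sub_self, sign_zero, if_neg (by omega), if_neg (by omega)]
      · have h' : (k : ℝ) < 2 * p i := by exact_mod_cast h
        rw [sign_pos (by linarith), if_neg (by omega), if_pos (by omega)]
    · exact (congrFun h q).symm
  · rintro ⟨u, hu, rfl⟩
    obtain ⟨l, p, k, hp, hk1, hk2, h⟩ := exists_isPartitionOf u
    exact ⟨_, hu, l, p, k, hp, hk1, hk2, h⟩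

end SweepBig

/-! ### Supports, flags and rank -/

namespace SignVec

variable {E : Type*}

lemma comp_eq_zero_iff {X Y : E → SignType} {e : E} : comp X Y e = 0 ↔ X e = 0 ∧ Y e = 0 := by
  unfold comp
  split_ifs with h <;> simp [h]

lemma Conf.trans {X Y Z : E → SignType} (h : Conf X Y) (h' : Conf Y Z) : Conf X Z := by
  intro e
  rcases h e with h1 | h1
  · exact Or.inl h1
  · rw [h1]
    exact h' e

lemma reorient_eq_zero_iff {A : Set E} {X : E → SignType} {e : E} :
    reorient A X e = 0 ↔ X e = 0 := by
  unfold reorient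
  split_ifs <;> simp

lemma reorient_reorient (A : Set E) (X : E → SignType) : reorient A (reorient A X) = X := by
  funext e
  unfold reorient
  split_ifs <;> simp

lemma exists_separates_of_ne_zero {X Y : E → SignType} {e : E} (hX : X e ≠ 0) (hY : Y e ≠ 0) :
    Separates X Y e ∨ Separates X (fun e => -Y e) e := by
  unfold Separates
  dsimp only
  generalize X e = x at *
  generalize Y e = y at *
  revert x y
  decide

end SignVec

namespace OrientedMatroid

variable {E : Type*}

/-- There is a sequence of `k + 1` covectors with strictly growing supports. -/
def HasFlag (M : OrientedMatroid E) (k : ℕ) : Prop :=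
  ∃ X : ℕ → E → SignType, (∀ i ≤ k, X i ∈ M.covectors) ∧
    ∀ i < k, (∀ e, X (i + 1) e = 0 → X i e = 0) ∧ ∃ e, X i e = 0 ∧ X (i + 1) e ≠ 0

lemma HasChain.hasFlag {M : OrientedMatroid E} {k : ℕ} (h : M.HasChain k) : M.HasFlag k := by
  obtain ⟨X, hX, hlt⟩ := h
  refine ⟨X, hX, fun i hi => ⟨fun e he => ?_, ?_⟩⟩
  · rcases (hlt i hi).1 e with h | h
    · exact h
    · rw [h, he]
  · by_contra hcon
    push Not at hcon
    refine (hlt i hi).2 (funext fun e => ?_)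
    rcases (hlt i hi).1 e with h | h
    · rw [h, hcon e h]
    · exact h

lemma HasFlag.hasChain {M : OrientedMatroid E} {k : ℕ} (h : M.HasFlag k) : M.HasChain k := by
  obtain ⟨X, hX, hlt⟩ := h
  -- Successive compositions keep the supports, which are nested, and make the signs conform.
  set Z : ℕ → E → SignType := fun i => Nat.rec (X 0) (fun i Z => comp Z (X (i + 1))) i with hZ
  have hZs : ∀ i, Z (i + 1) = comp (Z i) (X (i + 1)) := fun i => rfl
  have hsupp : ∀ i ≤ k, Z i ∈ M.covectors ∧ ∀ e, Z i e = 0 ↔ X i e = 0 := by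
    intro i
    induction i with
    | zero => exact fun _ => ⟨hX 0 (Nat.zero_le _), fun e => Iff.rfl⟩
    | succ i ih =>
      intro hi
      obtain ⟨h1, h2⟩ := ih (by omega)
      refine ⟨hZs i ▸ M.comp_mem _ h1 _ (hX _ hi), fun e => ?_⟩
      rw [hZs, comp_eq_zero_iff, h2]
      exact ⟨fun h => h.2, fun h => ⟨(hlt i (by omega)).1 e h, h⟩⟩
  refine ⟨Z, fun i hi => (hsupp i hi).1, fun i hi => ⟨fun e => ?_, fun heq => ?_⟩⟩
  · rw [hZs]
    unfold comp
    by_cases h : Z i e = 0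
    · exact Or.inl h
    · exact Or.inr (by rw [if_neg h])
  · obtain ⟨e, h1, h2⟩ := (hlt i hi).2
    rw [← (hsupp i hi.le).2, heq, (hsupp (i + 1) hi).2] at h1
    exact h2 h1

/-- Flags involve only zero sets, so rank can be compared across reorientations and restrictions
without tracking signs. -/
lemma hasChain_iff_hasFlag {M : OrientedMatroid E} {k : ℕ} : M.HasChain k ↔ M.HasFlag k :=
  ⟨HasChain.hasFlag, HasFlag.hasChain⟩

lemma hasRank_congr {F : Type*} {M : OrientedMatroid E} {N : OrientedMatroid F}
    (h : ∀ k, M.HasFlag k ↔ N.HasFlag k) (r : ℕ) : M.HasRank r ↔ N.HasRank r := by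
  unfold HasRank
  simp only [hasChain_iff_hasFlag, h]

lemma mem_reorient_iff {M : OrientedMatroid E} {A : Set E} {X : E → SignType} :
    X ∈ (M.reorient A).covectors ↔ SignVec.reorient A X ∈ M.covectors := by
  constructor
  · rintro ⟨Y, hY, rfl⟩
    rwa [reorient_reorient]
  · intro h
    exact ⟨_, h, (reorient_reorient A X).symm⟩

lemma HasFlag.reorient {M : OrientedMatroid E} {k : ℕ} (A : Set E) (h : M.HasFlag k) :
    (M.reorient A).HasFlag k := by
  obtain ⟨X, hX, hlt⟩ := h
  refine ⟨fun i => SignVec.reorient A (X i), fun i hi => ⟨_, hX i hi, rfl⟩, fun i hi => ?_⟩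
  simpa only [ne_eq, reorient_eq_zero_iff] using hlt i hi

lemma reorient_reorient (M : OrientedMatroid E) (A : Set E) : (M.reorient A).reorient A = M := by
  ext X
  rw [mem_reorient_iff, mem_reorient_iff, SignVec.reorient_reorient]

lemma hasRank_reorient_iff {M : OrientedMatroid E} {A : Set E} {r : ℕ} :
    (M.reorient A).HasRank r ↔ M.HasRank r :=
  hasRank_congr (fun k => ⟨fun h => by simpa only [reorient_reorient] using h.reorient A,
    fun h => h.reorient A⟩) r

/-- A flag of an extension by an element that is not a coloop gives a flag of the same length. -/
lemma HasFlag.of_restrict_aux {M : OrientedMatroid (Option E)}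
    (hM : ∀ X ∈ M.covectors, (∀ e, X (some e) = 0) → X none = 0) {k : ℕ} (m : ℕ) :
    ∀ X : ℕ → Option E → SignType, m < k → (∀ e, X 0 e = 0) → (∀ i ≤ k, X i ∈ M.covectors) →
    (∀ i < k, (∀ e, X (i + 1) e = 0 → X i e = 0) ∧ ∃ e, X i e = 0 ∧ X (i + 1) e ≠ 0) →
    X m none = 0 → X (m + 1) none ≠ 0 → (M.restrict Function.Embedding.some).HasFlag k := by
  -- The element `none` enters the support at step `m`. If an old element enters at the same step,
  -- deleting `none` keeps every inclusion strict.
  have key : ∀ m, ∀ X : ℕ → Option E → SignType, (∀ i ≤ k, X i ∈ M.covectors) →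
      (∀ i < k, (∀ e, X (i + 1) e = 0 → X i e = 0) ∧ ∃ e, X i e = 0 ∧ X (i + 1) e ≠ 0) →
      m < k → X m none = 0 → X (m + 1) none ≠ 0 →
      (∃ e, X m (some e) = 0 ∧ X (m + 1) (some e) ≠ 0) →
      (M.restrict Function.Embedding.some).HasFlag k := by
    intro m X hX hlt hmk hm hm' he
    refine ⟨fun i e => X i (some e), fun i hi => ⟨_, hX i hi, rfl⟩,
      fun i hi => ⟨fun e => (hlt i hi).1 (some e), ?_⟩⟩
    obtain ⟨e, he1, he2⟩ := (hlt i hi).2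
    rcases e with _ | e
    · rcases lt_trichotomy i m with h | h | h
      · have hz : ∀ j, j + i ≤ m → X (m - j) none = 0 := by
          intro j
          induction j with
          | zero => exact fun _ => hm
          | succ j ih =>
            intro hj
            have h3 := ih (by omega)
            have h4 := (hlt (m - (j + 1)) (by omega)).1 none
            rw [show m - (j + 1) + 1 = m - j by omega] at h4
            exact h4 h3
        have := hz (m - (i + 1)) (by omega)
        rw [show m - (m - (i + 1)) = i + 1 by omega] at this
        exact absurd this he2
      · subst h
        exact he
      · have hz : ∀ j, m + 1 + j ≤ k → X (m + 1 + j) none ≠ 0 := by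
          intro j
          induction j with
          | zero => exact fun _ => hm'
          | succ j ih => exact fun hj h0 => ih (by omega) ((hlt (m + 1 + j) (by omega)).1 none h0)
        have := hz (i - (m + 1)) (by omega)
        rw [show m + 1 + (i - (m + 1)) = i by omega] at this
        exact absurd he1 this
    · exact ⟨e, he1, he2⟩
  induction m with
  | zero =>
    intro X hmk h0 hX hlt hm hm'
    refine key 0 X hX hlt hmk hm hm' ?_
    by_contra hcon
    push Not at hcon
    exact hm' (hM _ (hX 1 hmk) (fun e => hcon e (h0 _)))
  | succ m ih =>
    intro X hmk h0 hX hlt hm hm'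
    by_cases he : ∃ e, X (m + 1) (some e) = 0 ∧ X (m + 1 + 1) (some e) ≠ 0
    · exact key (m + 1) X hX hlt hmk hm hm' he
    push Not at he
    have hm0 : X m none = 0 := (hlt m (by omega)).1 none hm
    obtain ⟨e, he1, he2⟩ := (hlt m (by omega)).2
    rcases e with _ | e
    · exact absurd hm he2
    have he3 : X (m + 1 + 1) (some e) ≠ 0 := fun h => he2 ((hlt (m + 1) hmk).1 _ h)
    obtain ⟨X', hX', hXz, hsep⟩ : ∃ X' ∈ M.covectors, (∀ e, X' e = 0 ↔ X (m + 1) e = 0) ∧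
        Separates (X (m + 1 + 1)) X' (some e) := by
      rcases exists_separates_of_ne_zero he3 he2 with h | h
      · exact ⟨_, hX (m + 1) (by omega), fun _ => Iff.rfl, h⟩
      · exact ⟨_, M.neg_mem _ (hX (m + 1) (by omega)), fun e => by simp, h⟩
    -- Now only `none` enters at step `m + 1`, while the old element `e` enters at step `m`.
    -- Replacing the middle covector by the composition of `X m` with `W` swaps these: `none` enters
    -- one step earlier and `e` one step later. The induction ends at the zero vector, where `hM`
    -- applies.
    obtain ⟨W, hW, hWe, hWf⟩ := M.elim _ (hX (m + 1 + 1) hmk) _ hX' _ hsep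
    have hWn : W none ≠ 0 := by
      rw [hWf none (fun h => hm' (by have := h.2; rw [(hXz none).2 hm] at this; simpa using this.symm))]
      exact fun h => hm' (comp_eq_zero_iff.1 h).1
    have hWz : ∀ g, X (m + 1 + 1) g = 0 → W g = 0 := by
      intro g hg
      rw [hWf g (fun h => h.1 hg)]
      exact comp_eq_zero_iff.2 ⟨hg, (hXz g).2 ((hlt (m + 1) hmk).1 g hg)⟩
    have hup : Function.update X (m + 1) (comp (X m) W) (m + 1) = comp (X m) W := by simp
    have hne : ∀ i, i ≠ m + 1 → Function.update X (m + 1) (comp (X m) W) i = X i :=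
      fun i hi => Function.update_of_ne hi _ _
    refine ih (Function.update X (m + 1) (comp (X m) W)) (by omega)
      (by rw [hne 0 (by omega)]; exact h0) (fun i hi => ?_) (fun i hi => ?_)
      (by rw [hne m (by omega)]; exact hm0)
      (by rw [hup]; exact fun h => hWn (comp_eq_zero_iff.1 h).2)
    · by_cases h : i = m + 1
      · subst h
        rw [hup]
        exact M.comp_mem _ (hX m (by omega)) _ hW
      · rw [hne i h]
        exact hX i hi
    · by_cases h : i = m + 1
      · subst h
        rw [hup, hne (m + 1 + 1) (by omega)]
        refine ⟨fun g hg => comp_eq_zero_iff.2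
          ⟨(hlt m (by omega)).1 g ((hlt (m + 1) hmk).1 g hg), hWz g hg⟩,
          some e, comp_eq_zero_iff.2 ⟨he1, hWe⟩, he3⟩
      · rw [hne i h]
        by_cases h' : i = m
        · subst h'
          rw [hup]
          exact ⟨fun g hg => (comp_eq_zero_iff.1 hg).1, none, hm0,
            fun h => hWn (comp_eq_zero_iff.1 h).2⟩
        · rw [hne (i + 1) (by omega)]
          exact hlt i hi

/-- Adding an element that is not a coloop does not change the lengths of flags. -/
lemma hasFlag_restrict_some_iff {M : OrientedMatroid (Option E)}
    (hM : ∀ X ∈ M.covectors, (∀ e, X (some e) = 0) → X none = 0) (k : ℕ) :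
    (M.restrict Function.Embedding.some).HasFlag k ↔ M.HasFlag k := by
  constructor
  · rintro ⟨X, hX, hlt⟩
    have hY : ∀ i, ∃ Y : Option E → SignType, i ≤ k → Y ∈ M.covectors ∧
        X i = fun e => Y (some e) := by
      intro i
      by_cases hi : i ≤ k
      · obtain ⟨Y, hY, h⟩ := hX i hi
        exact ⟨Y, fun _ => ⟨hY, h⟩⟩
      · exact ⟨fun _ => 0, fun h => absurd h hi⟩
    choose Y hY using hY
    -- The lifts are composed because their entries at `none` need not have nested supports.
    set Z : ℕ → Option E → SignType :=
      fun i => Nat.rec (Y 0) (fun i Z => comp Z (Y (i + 1))) i with hZ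
    have hZs : ∀ i, Z (i + 1) = comp (Z i) (Y (i + 1)) := fun i => rfl
    have hZX : ∀ i ≤ k, Z i ∈ M.covectors ∧ ∀ e, Z i (some e) = 0 ↔ X i e = 0 := by
      intro i
      induction i with
      | zero => exact fun h => ⟨(hY 0 h).1, fun e => by rw [(hY 0 h).2]; exact Iff.rfl⟩
      | succ i ih =>
        intro hi
        obtain ⟨h1, h2⟩ := ih (by omega)
        refine ⟨hZs i ▸ M.comp_mem _ h1 _ (hY _ hi).1, fun e => ?_⟩
        have h3 : Y (i + 1) (some e) = X (i + 1) e := by rw [(hY _ hi).2]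
        rw [hZs, comp_eq_zero_iff, h2, h3]
        exact ⟨fun h => h.2, fun h => ⟨(hlt i (by omega)).1 e h, h⟩⟩
    refine ⟨Z, fun i hi => (hZX i hi).1, fun i hi => ⟨fun e he => ?_, ?_⟩⟩
    · rw [hZs] at he
      exact (comp_eq_zero_iff.1 he).1
    · obtain ⟨e, h1, h2⟩ := (hlt i hi).2
      exact ⟨some e, ((hZX i hi.le).2 e).2 h1, fun h => h2 (((hZX (i + 1) hi).2 e).1 h)⟩
  · rintro ⟨X, hX, hlt⟩
    by_cases hk : k = 0
    · subst hk
      exact ⟨fun i e => X i (some e), fun i hi => ⟨_, hX i hi, rfl⟩,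
        fun i hi => absurd hi (Nat.not_lt_zero i)⟩
    -- The first covector of a flag may be replaced by zero, which is the starting point that
    -- `HasFlag.of_restrict_aux` requires.
    have hup : Function.update X 0 (fun _ => 0) 0 = fun _ => 0 := by simp
    have hne : ∀ i, i ≠ 0 → Function.update X 0 (fun _ => 0) i = X i :=
      fun i hi => Function.update_of_ne hi _ _
    have hX' : ∀ i ≤ k, Function.update X 0 (fun _ => 0) i ∈ M.covectors := by
      intro i hi
      by_cases h : i = 0
      · subst h
        rw [hup]
        exact M.zero_mem
      · rw [hne i h]
        exact hX i hi
    have hlt' : ∀ i < k, (∀ e, Function.update X 0 (fun _ => 0) (i + 1) e = 0 →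
        Function.update X 0 (fun _ => 0) i e = 0) ∧
        ∃ e, Function.update X 0 (fun _ => 0) i e = 0 ∧
          Function.update X 0 (fun _ => 0) (i + 1) e ≠ 0 := by
      intro i hi
      rw [hne (i + 1) (by omega)]
      obtain ⟨e, he1, he2⟩ := (hlt i hi).2
      by_cases h : i = 0
      · subst h
        rw [hup]
        exact ⟨fun _ _ => rfl, e, rfl, he2⟩
      · rw [hne i h]
        exact hlt i hi
    generalize Function.update X 0 (fun _ => 0) = X₁ at hup hX' hlt'
    by_cases hj : ∃ m < k, X₁ m none = 0 ∧ X₁ (m + 1) none ≠ 0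
    · obtain ⟨m, hm, h1, h2⟩ := hj
      exact HasFlag.of_restrict_aux hM m X₁ hm (fun e => by rw [hup]) hX' hlt' h1 h2
    · push Not at hj
      refine ⟨fun i e => X₁ i (some e), fun i hi => ⟨_, hX' i hi, rfl⟩,
        fun i hi => ⟨fun e => (hlt' i hi).1 (some e), ?_⟩⟩
      obtain ⟨e, he1, he2⟩ := (hlt' i hi).2
      rcases e with _ | e
      · exact absurd (hj i hi he1) he2
      · exact ⟨e, he1, he2⟩

/-- Elimination of `e` between two covectors with nested supports that contain `e`. -/
lemma exists_elim_of_nested {M : OrientedMatroid E} {X Y : E → SignType} (hX : X ∈ M.covectors)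
    (hY : Y ∈ M.covectors) (hXY : ∀ g, Y g = 0 → X g = 0) {e : E} (he : X e ≠ 0) :
    ∃ Z ∈ M.covectors, Z e = 0 ∧ (∀ g, Y g = 0 → Z g = 0) ∧
      ∀ g, X g = 0 → Y g ≠ 0 → Z g ≠ 0 := by
  obtain ⟨X', hX', hXz, hsep⟩ : ∃ X' ∈ M.covectors, (∀ e, X' e = 0 ↔ X e = 0) ∧
      Separates Y X' e := by
    rcases exists_separates_of_ne_zero (X := Y) (fun h => he (hXY e h)) he with h | h
    · exact ⟨_, hX, fun _ => Iff.rfl, h⟩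
    · exact ⟨_, M.neg_mem _ hX, fun e => by simp, h⟩
  obtain ⟨Z, hZ, hZe, hZf⟩ := M.elim _ hY _ hX' e hsep
  refine ⟨Z, hZ, hZe, fun g hg => ?_, fun g hg hg' => ?_⟩
  · rw [hZf g (fun h => h.1 hg)]
    exact comp_eq_zero_iff.2 ⟨hg, (hXz g).2 (hXY g hg)⟩
  · rw [hZf g (fun h => hg' (by have := h.2; rw [(hXz g).2 hg] at this; simpa using this.symm))]
    exact fun h => hg' (comp_eq_zero_iff.1 h).1

/-! ### Minimal nonzero covectors -/

section MinimalFaces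

variable [Fintype E]

open Classical in
/-- Below a minimal nonzero covector `Y` there is, up to sign, only `Y`. -/
lemma eq_or_eq_neg_of_minimal_aux {M : OrientedMatroid E} {Y : E → SignType}
    (hY : Y ∈ M.covectors)
    (hmin : ∀ Z ∈ M.covectors, (∃ e, Z e ≠ 0) → Conf Z Y → Z = Y) (N : ℕ) :
    ∀ W ∈ M.covectors, (Finset.univ.filter fun e => Separates Y W e).card < N →
    (∀ e, Y e = 0 → W e = 0) → (∃ e, W e ≠ 0) → W = Y ∨ W = fun e => -Y e := by
  induction N with
  | zero => exact fun W _ h => absurd h (Nat.not_lt_zero _)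
  | succ N ih =>
    intro W hW hcard hz hne
    by_cases hs : ∃ e, Separates Y W e
    · obtain ⟨e, he⟩ := hs
      obtain ⟨V, hV, hVe, hVf⟩ := M.elim _ hY _ hW e he
      -- A nonzero `V` would be `Y` or its negative by induction, although `V e = 0` and `Y e ≠ 0`.
      -- So `V` vanishes, which forces `W` to be the negative of `Y`.
      by_cases hV0 : ∃ e, V e ≠ 0
      · have hVz : ∀ g, Y g = 0 → V g = 0 := fun g hg => by
          rw [hVf g (fun h => h.1 hg)]
          exact comp_eq_zero_iff.2 ⟨hg, hz g hg⟩
        have := ih V hV (by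
          refine lt_of_lt_of_le (Finset.card_lt_card ⟨fun g hg => ?_, fun hsub => ?_⟩)
            (Nat.lt_succ_iff.1 hcard)
          · simp only [Finset.mem_filter, Finset.mem_univ, true_and] at hg ⊢
            by_contra hg'
            exact (not_separates_left hg' (hVf g hg')).1 hg
          · have := hsub (Finset.mem_filter.2 ⟨Finset.mem_univ e, he⟩)
            have h2 := (Finset.mem_filter.1 this).2.2
            rw [hVe] at h2
            exact he.1 (by simpa using h2.symm)) hVz hV0
        rcases this with h | h
        · exact absurd (by rw [← h]; exact hVe) he.1
        · rw [h] at hVe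
          exact absurd (by simpa using hVe) he.1
      · push Not at hV0
        refine Or.inr (funext fun g => ?_)
        by_cases hg : Separates Y W g
        · exact hg.2
        · have h1 := hVf g hg
          rw [hV0 g] at h1
          obtain ⟨h2, h3⟩ := comp_eq_zero_iff.1 h1.symm
          rw [h2, h3]
          rfl
    · push Not at hs
      refine Or.inl (hmin W hW hne fun e => ?_)
      by_cases hWe : W e = 0
      · exact Or.inl hWe
      · refine Or.inr ?_
        have h1 := hs e
        have h2 := hz e
        unfold Separates at h1
        generalize W e = w at *
        generalize Y e = y at *
        clear hcard
        revert w y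
        decide

lemma eq_or_eq_neg_of_minimal {M : OrientedMatroid E} {Y W : E → SignType}
    (hY : Y ∈ M.covectors)
    (hmin : ∀ Z ∈ M.covectors, (∃ e, Z e ≠ 0) → Conf Z Y → Z = Y) (hW : W ∈ M.covectors)
    (hz : ∀ e, Y e = 0 → W e = 0) (hne : ∃ e, W e ≠ 0) : W = Y ∨ W = fun e => -Y e := by
  classical
  exact eq_or_eq_neg_of_minimal_aux hY hmin _ W hW (Nat.lt_succ_self _) hz hne

/-- In rank at least four, the zeros of a minimal nonzero covector are not all parallel. -/
lemma exists_not_parallel {M : OrientedMatroid E} (hM : M.HasFlag 4) {Y : E → SignType}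
    (hY : Y ∈ M.covectors)
    (hmin : ∀ Z ∈ M.covectors, (∃ e, Z e ≠ 0) → Conf Z Y → Z = Y) :
    ∃ i j, Y i = 0 ∧ Y j = 0 ∧ ∃ X ∈ M.covectors, X i = 0 ∧ X j ≠ 0 := by
  by_contra hcon
  push Not at hcon
  obtain ⟨X, hX, hlt⟩ := hM
  -- Two nonzero covectors vanishing on the zeros of `Y` are both `Y` up to sign, so their supports
  -- coincide; such `A` and `B` contradict this.
  suffices h : ∃ A ∈ M.covectors, ∃ B ∈ M.covectors, (∀ e, Y e = 0 → A e = 0) ∧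
      (∀ e, Y e = 0 → B e = 0) ∧ (∃ e, A e ≠ 0) ∧ ∃ g, A g = 0 ∧ B g ≠ 0 by
    obtain ⟨A, hA, B, hB, hAz, hBz, hA0, g, hAg, hBg⟩ := h
    have h1 := eq_or_eq_neg_of_minimal hY hmin hA hAz hA0
    have h2 := eq_or_eq_neg_of_minimal hY hmin hB hBz ⟨g, hBg⟩
    have h3 : Y g = 0 := by
      rcases h1 with h | h <;> rw [h] at hAg
      · exact hAg
      · simpa using hAg
    exact hBg (hBz g h3)
  obtain ⟨g1, -, h1⟩ := (hlt 0 (by norm_num)).2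
  obtain ⟨h12, g2, h2, h2'⟩ := hlt 1 (by norm_num)
  obtain ⟨h23, g3, h3, h3'⟩ := hlt 2 (by norm_num)
  obtain ⟨h34, g4, h4, h4'⟩ := hlt 3 (by norm_num)
  norm_num at h1 h12 h2 h2' h23 h3 h3' h34 h4 h4'
  by_cases hz : ∃ e, Y e = 0
  · obtain ⟨e, he⟩ := hz
    have hpar : ∀ Z ∈ M.covectors, Z e = 0 → ∀ g, Y g = 0 → Z g = 0 :=
      fun Z hZ hZe g hg => hcon e g he hg Z hZ hZe
    -- All zeros of `Y` are parallel to `e`, so vanishing at `e` suffices. If `X 2 e ≠ 0`, then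
    -- eliminating `e` in the next two steps of the flag gives two such covectors; this is where
    -- length four is needed.
    by_cases he2 : X 2 e = 0
    · exact ⟨X 1, hX 1 (by norm_num), X 2, hX 2 (by norm_num),
        hpar _ (hX 1 (by norm_num)) (h12 e he2), hpar _ (hX 2 (by norm_num)) he2, ⟨g1, h1⟩,
        g2, h2, h2'⟩
    · obtain ⟨A, hA, hAe, hA1, hA2⟩ := exists_elim_of_nested (hX 2 (by norm_num))
        (hX 3 (by norm_num)) h23 he2
      obtain ⟨B, hB, hBe, hB1, hB2⟩ := exists_elim_of_nested (hX 3 (by norm_num))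
        (hX 4 (by norm_num)) h34 (fun h => he2 (h23 e h))
      exact ⟨A, hA, B, hB, hpar A hA hAe, hpar B hB hBe, ⟨g3, hA2 g3 h3 h3'⟩, g4,
        hA1 g4 h4, hB2 g4 h4 h4'⟩
  · push Not at hz
    exact ⟨X 1, hX 1 (by norm_num), X 2, hX 2 (by norm_num), fun e he => absurd he (hz e),
      fun e he => absurd he (hz e), ⟨g1, h1⟩, g2, h2, h2'⟩

open Classical in
/-- Every nonzero covector lies above a minimal one. -/
lemma exists_minimal_conf {M : OrientedMatroid E} {T : E → SignType} (hT : T ∈ M.covectors)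
    (hne : ∃ e, T e ≠ 0) : ∃ Y ∈ M.covectors, (∃ e, Y e ≠ 0) ∧ Conf Y T ∧
      ∀ Z ∈ M.covectors, (∃ e, Z e ≠ 0) → Conf Z Y → Z = Y := by
  obtain ⟨Y, ⟨hY, hY0, hYT⟩, hmin⟩ := exists_minimalFor_of_wellFoundedLT
    (fun Y : E → SignType => Y ∈ M.covectors ∧ (∃ e, Y e ≠ 0) ∧ Conf Y T)
    (fun Y => (Finset.univ.filter fun e => Y e ≠ 0).card) ⟨T, hT, hne, fun e => Or.inr rfl⟩
  refine ⟨Y, hY, hY0, hYT, fun Z hZ hZ0 hZY => ?_⟩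
  have hsub : (Finset.univ.filter fun e => Z e ≠ 0) ⊆ Finset.univ.filter fun e => Y e ≠ 0 := by
    intro e he
    simp only [Finset.mem_filter, Finset.mem_univ, true_and] at he ⊢
    rcases hZY e with h | h
    · exact absurd h he
    · rwa [← h]
  have heq := Finset.eq_of_subset_of_card_le hsub
    (hmin ⟨hZ, hZ0, hZY.trans hYT⟩ (Finset.card_le_card hsub))
  funext e
  rcases hZY e with h | h
  · by_contra hne
    have : e ∈ Finset.univ.filter fun e => Y e ≠ 0 := by
      simp only [Finset.mem_filter, Finset.mem_univ, true_and]
      exact fun h' => hne (h.trans h'.symm)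
    rw [← heq] at this
    exact (Finset.mem_filter.1 this).2 h
  · exact h

end MinimalFaces

/-! ### From a little oriented matroid to an extension that meets both topes -/

lemma mem_of_isLittle {n : ℕ} {L : OrientedMatroid (Fin n)} {S : OrientedMatroid (Pairs n)}
    (hS : S.IsSweep) (hL : L.covectors = S.littleCovectors) {X : Fin n → SignType} :
    X ∈ L.covectors ↔ ∃ u, pairSign u ∈ S.covectors ∧ X = fun i => SignType.sign (u i) := by
  rw [hL]
  unfold littleCovectors
  rw [bigCovectors_eq hS]
  constructor
  · rintro ⟨_, ⟨u, hu, rfl⟩, rfl⟩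
    exact ⟨u, hu, rfl⟩
  · rintro ⟨u, hu, rfl⟩
    exact ⟨_, ⟨u, hu, rfl⟩, rfl⟩

/-- The element of the big oriented matroid that corresponds to the pair `i`, `j`. -/
lemma exists_pair {n : ℕ} {i j : Fin n} (hij : i ≠ j) :
    ∃ q : Pairs n, ∀ u : Fin n → ℝ, pairSign u q = 0 ↔ u i = u j := by
  rcases lt_or_gt_of_ne hij with h | h
  · refine ⟨⟨(i, j), h⟩, fun u => ?_⟩
    unfold pairSign
    rw [sign_eq_zero_iff, sub_eq_zero, eq_comm]
  · refine ⟨⟨(j, i), h⟩, fun u => ?_⟩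
    unfold pairSign
    rw [sign_eq_zero_iff, sub_eq_zero]

/-- If a reorientation of `M` that sends the tope `U` to the all-positive vector is a little
oriented matroid, then some extension of `M` meets `U` and any other given tope. -/
theorem exists_extension_of_isLittle {n : ℕ} {M : OrientedMatroid (Fin n)} {r : ℕ}
    (hr : M.HasRank r) (hr4 : M.HasFlag 4) {U T : Fin n → SignType} (hU : ∀ e, U e ≠ 0)
    (hT : M.IsTope T) (hL : (M.reorient {e | U e = -1}).IsLittle) :
    ∃ M' : OrientedMatroid (Option (Fin n)),
      M.IsOneElementExtension M' ∧ M'.NewElementMeets U ∧ M'.NewElementMeets T := by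
  classical
  set A : Set (Fin n) := {e | U e = -1} with hA
  obtain ⟨S, hS, hL⟩ := hL
  have hmem : ∀ X, X ∈ M.covectors ↔
      ∃ u, pairSign u ∈ S.covectors ∧ X = SignVec.reorient A fun i => SignType.sign (u i) := by
    intro X
    rw [← reorient_reorient M A, mem_reorient_iff, mem_of_isLittle hS hL]
    constructor
    · rintro ⟨u, hu, h⟩
      exact ⟨u, hu, by rw [← h, SignVec.reorient_reorient]⟩
    · rintro ⟨u, hu, h⟩
      exact ⟨u, hu, by rw [h, SignVec.reorient_reorient]⟩
  have hT0 : ∃ e, T e ≠ 0 := by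
    by_contra hcon
    push Not at hcon
    obtain ⟨X, hX, hlt⟩ := hr4
    obtain ⟨e, -, he⟩ := (hlt 0 (by norm_num)).2
    have := hT.2 _ (hX 1 (by norm_num)) (fun e => Or.inl (hcon e))
    exact he (by rw [zero_add, this]; exact hcon e)
  obtain ⟨Y, hY, hY0, hYT, hmin⟩ := exists_minimal_conf hT.1 hT0
  -- The pair of `i` and `j` will be the new element: it vanishes on `Y`, and the covector `X` shows
  -- that it is not a loop.
  obtain ⟨i, j, hYi, hYj, X, hX, hXi, hXj⟩ := exists_not_parallel hr4 hY hmin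
  have hij : i ≠ j := fun h => hXj (h ▸ hXi)
  obtain ⟨q, hq⟩ := exists_pair hij
  let φ : Option (Fin n) ↪ Fin n ⊕ Pairs n :=
    ⟨fun o => o.elim (Sum.inr q) Sum.inl, by
      rintro (_ | a) (_ | b) h
      · rfl
      · exact absurd h (by simp)
      · exact absurd h (by simp)
      · exact congrArg some (Sum.inl_injective h)⟩
  let M' := ((S.big hS).restrict φ).reorient (some '' A)
  have hre : ∀ (Z : Option (Fin n) → SignType) i,
      SignVec.reorient (some '' A) Z (some i) = SignVec.reorient A (fun i => Z (some i)) i := by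
    intro Z i
    simp [SignVec.reorient]
  have hre' : ∀ Z : Option (Fin n) → SignType,
      SignVec.reorient (some '' A) Z none = Z none := by
    intro Z
    simp [SignVec.reorient]
  have hmem' : ∀ u, pairSign u ∈ S.covectors →
      ∃ Z ∈ M'.covectors, (Z none = 0 ↔ u i = u j) ∧
        (fun e => Z (some e)) = SignVec.reorient A fun i => SignType.sign (u i) := by
    intro u hu
    refine ⟨_, ⟨_, ⟨_, ⟨u, hu, rfl⟩, rfl⟩, rfl⟩, ?_, ?_⟩
    · rw [hre']
      exact hq u
    · funext e
      rw [hre]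
      rfl
  have hmem'' : ∀ Z ∈ M'.covectors, ∃ u, pairSign u ∈ S.covectors ∧ (Z none = 0 ↔ u i = u j) ∧
        (fun e => Z (some e)) = SignVec.reorient A fun i => SignType.sign (u i) := by
    rintro _ ⟨_, ⟨_, ⟨u, hu, rfl⟩, rfl⟩, rfl⟩
    refine ⟨u, hu, ?_, ?_⟩
    · rw [hre']
      exact hq u
    · funext e
      rw [hre]
      rfl
  have hrestrict : M'.restrict Function.Embedding.some = M := by
    ext Z
    rw [hmem]
    constructor
    · rintro ⟨Z', hZ', rfl⟩
      obtain ⟨u, hu, -, h⟩ := hmem'' Z' hZ'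
      exact ⟨u, hu, h⟩
    · rintro ⟨u, hu, rfl⟩
      obtain ⟨Z', hZ', -, h⟩ := hmem' u hu
      exact ⟨Z', hZ', h.symm⟩
  have hzero : ∀ u : Fin n → ℝ, ∀ Z : Option (Fin n) → SignType,
      (fun e => Z (some e)) = SignVec.reorient A (fun i => SignType.sign (u i)) →
      ∀ e, Z (some e) = 0 ↔ u e = 0 := by
    intro u Z h e
    rw [show Z (some e) = SignVec.reorient A (fun i => SignType.sign (u i)) e from congrFun h e,
      reorient_eq_zero_iff, sign_eq_zero_iff]
  -- If all old entries vanish then `u i = u j = 0`, so the new element is not a coloop and the rank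
  -- is unchanged.
  have hcoloop : ∀ Z ∈ M'.covectors, (∀ e, Z (some e) = 0) → Z none = 0 := by
    intro Z hZ h0
    obtain ⟨u, -, h1, h2⟩ := hmem'' Z hZ
    rw [h1, (hzero u Z h2 i).1 (h0 i), (hzero u Z h2 j).1 (h0 j)]
  refine ⟨M', ⟨hrestrict, fun hloop => ?_, r, hr, ?_⟩, ?_, ?_⟩
  · obtain ⟨u, hu, rfl⟩ := (hmem X).1 hX
    obtain ⟨Z, hZ, h1, -⟩ := hmem' u hu
    rw [reorient_eq_zero_iff, sign_eq_zero_iff] at hXi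
    rw [ne_eq, reorient_eq_zero_iff, sign_eq_zero_iff] at hXj
    exact hXj (by rw [← h1.1 (hloop Z hZ), hXi])
  · refine (hasRank_congr (fun k => ?_) r).1 hr
    rw [← hasFlag_restrict_some_iff hcoloop, hrestrict]
  -- The constant vector `1` comes from the zero covector of `S`. All its differences vanish, and
  -- reorientation turns its signs into `U`.
  · have h1 : pairSign (fun _ : Fin n => (1 : ℝ)) = fun _ => 0 := by
      funext p
      simp [pairSign]
    obtain ⟨Z, hZ, h2, h3⟩ := hmem' (fun _ => 1) (h1 ▸ S.zero_mem)
    refine ⟨Z, hZ, h2.2 rfl, ⟨i, ?_⟩, fun e => Or.inr ?_⟩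
    · rw [ne_eq, hzero _ Z h3]
      exact one_ne_zero
    · rw [h3]
      have := hU e
      unfold SignVec.reorient
      simp only [hA, Set.mem_ofPred_eq, sign_one]
      generalize U e = x at *
      revert x
      decide
  · obtain ⟨u, hu, rfl⟩ := (hmem Y).1 hY
    obtain ⟨Z, hZ, h1, h2⟩ := hmem' u hu
    rw [reorient_eq_zero_iff, sign_eq_zero_iff] at hYi hYj
    refine ⟨Z, hZ, h1.2 (by rw [hYi, hYj]), ?_, by rw [h2]; exact hYT⟩
    obtain ⟨e, he⟩ := hY0
    exact ⟨e, by rwa [show Z (some e) = _ from congrFun h2 e]⟩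

lemma isAcyclic_reorient {M : OrientedMatroid E} {U : E → SignType} (hU : U ∈ M.covectors)
    (hU0 : ∀ e, U e ≠ 0) : (M.reorient {e | U e = -1}).IsAcyclic := by
  refine ⟨⟨U, hU, funext fun e => ?_⟩, fun Y _ hY => funext fun e => ?_⟩
  · have := hU0 e
    unfold SignVec.reorient
    simp only [Set.mem_ofPred_eq]
    split_ifs with h
    · rw [h]; rfl
    · generalize U e = x at *
      revert x
      decide
  · rcases hY e with h | h
    · exact absurd h (by simp)
    · exact h.symm

theorem IsRichterGebert.isAcyclic_and_not_isLittle {M : OrientedMatroid (Fin 12)}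
    {U T : Fin 12 → SignType} (h : M.IsRichterGebert U T) :
    (M.reorient {e | U e = -1}).IsAcyclic ∧ ¬ (M.reorient {e | U e = -1}).IsLittle :=
  ⟨isAcyclic_reorient h.tope_left.1 h.full_support, fun hL => h.not_both
    (exists_extension_of_isLittle h.rank_four (hasChain_iff_hasFlag.1 h.rank_four.1)
      h.full_support h.tope_right hL)⟩

end OrientedMatroid

/-! Sign vectors on 12 elements, encoded by bitmaps. -/

namespace TopeBitmap

open SignVec

/-- The positive part of a sign vector as a bit mask. -/
def posMask (X : Fin 12 → SignType) : ℕ := ∑ e, if X e = 1 then 2 ^ (e : ℕ) else 0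

/-- The bitmap of the masks below `2 ^ 12` without the bit `a`. -/
def lowerHalf (a : ℕ) : ℕ := (2 ^ 4096 - 1) / (2 ^ 2 ^ a + 1)

/-- The masks `m` in `C` that do not contain `a` and for which `m ∪ {a}` is in `C`. -/
def contract (C a : ℕ) : ℕ := (C &&& (C >>> 2 ^ a)) &&& lowerHalf a

/-- The bitmap of the sign vectors with zero set `l` all whose full refinements are in `T`. -/
def cells (T : ℕ) : List (Fin 12) → ℕ
  | [] => T
  | a :: l => contract (cells T l) a

/-- `X` is zero, or all its full refinements are in the bitmap `T`. -/
def IsCell (T : ℕ) (X : Fin 12 → SignType) : Prop :=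
  (∀ e, X e = 0) ∨ ∀ Y : Fin 12 → SignType, (∀ e, Y e ≠ 0) → Conf X Y → T.testBit (posMask Y)

lemma posMask_eq_ofBits (X : Fin 12 → SignType) :
    posMask X = Nat.ofBits fun e => decide (X e = 1) := by
  have key : ∀ (n : ℕ) (f : Fin n → Bool),
      Nat.ofBits f = ∑ e, if f e then 2 ^ (e : ℕ) else 0 := by
    intro n
    induction n with
    | zero => intro f; simp
    | succ n ih =>
      intro f
      rw [Nat.ofBits_succ, ih, Fin.sum_univ_succ, Finset.mul_sum, add_comm]
      congr 1
      · cases f 0 <;> simp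
      · refine Finset.sum_congr rfl fun e _ => ?_
        simp [Function.comp, pow_succ, mul_comm]
  rw [key, posMask]
  simp

lemma posMask_lt (X : Fin 12 → SignType) : posMask X < 4096 := by
  rw [posMask_eq_ofBits]
  exact Nat.ofBits_lt_two_pow _

lemma testBit_posMask (X : Fin 12 → SignType) (e : Fin 12) :
    (posMask X).testBit e = decide (X e = 1) := by
  rw [posMask_eq_ofBits, Nat.testBit_ofBits_lt _ _ e.2]

lemma eq_of_posMask_eq {X Y : Fin 12 → SignType} (h : posMask X = posMask Y)
    (h0 : ∀ e, X e = 0 ↔ Y e = 0) : X = Y := by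
  funext e
  have h1 : decide (X e = 1) = decide (Y e = 1) := by
    rw [← testBit_posMask, ← testBit_posMask, h]
  have h2 := h0 e
  generalize X e = x at *
  generalize Y e = y at *
  revert x y
  decide

lemma posMask_update_one {X : Fin 12 → SignType} {a : Fin 12} (h : X a ≠ 1) :
    posMask (Function.update X a 1) = 2 ^ (a : ℕ) + posMask X := by
  unfold posMask
  rw [← Finset.add_sum_erase Finset.univ _ (Finset.mem_univ a),
    ← Finset.add_sum_erase Finset.univ (fun e => if X e = 1 then _ else _) (Finset.mem_univ a)]
  simp only [Function.update_self, if_true, if_neg h, zero_add]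
  congr 1
  refine Finset.sum_congr rfl fun e he => ?_
  rw [Function.update_of_ne (Finset.ne_of_mem_erase he)]

lemma posMask_update_of_ne_one {X : Fin 12 → SignType} {a : Fin 12} (h : X a ≠ 1) {s : SignType}
    (hs : s ≠ 1) : posMask (Function.update X a s) = posMask X := by
  unfold posMask
  refine Finset.sum_congr rfl fun e _ => ?_
  by_cases he : e = a
  · subst he
    simp [h, hs]
  · rw [Function.update_of_ne he]

/-- With `s = 2 ^ a`, the quotient is `2 ^ s - 1` times the sum of the powers `2 ^ (2 * s * k)` for
`2 * s * k < 4096`: blocks of `s` ones alternate with blocks of `s` zeros, just as bit `a` of the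
position does. -/
lemma testBit_lowerHalf {a m : ℕ} (ha : a < 12) (hm : m < 4096) :
    (lowerHalf a).testBit m = !m.testBit a := by
  have key : ∀ a < 12, ∀ i < 64, ∀ j < 64,
      (lowerHalf a).testBit (64 * i + j) = !(64 * i + j).testBit a := by
    decide +kernel
  have := key a ha (m / 64) (by omega) (m % 64) (by omega)
  rwa [Nat.div_add_mod] at this

/-- A zero at `a` leaves bit `a` of the mask off, and shifting by `2 ^ a` brings the mask with bit
`a` on to the same position. -/
lemma testBit_contract {C : ℕ} {X : Fin 12 → SignType} {a : Fin 12} (h : X a = 0) :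
    (contract C a).testBit (posMask X) =
      (C.testBit (posMask (Function.update X a (-1))) &&
        C.testBit (posMask (Function.update X a 1))) := by
  have h1 : X a ≠ 1 := by rw [h]; decide
  rw [posMask_update_one h1, posMask_update_of_ne_one h1 (by decide), contract,
    Nat.testBit_and, Nat.testBit_and, Nat.testBit_shiftRight,
    testBit_lowerHalf a.2 (posMask_lt X), testBit_posMask, h]
  simp

/-- Each contraction lets one zero take both signs, so after all of `l` every full refinement has
been tested. -/
lemma testBit_cells_iff {T : ℕ} (l : List (Fin 12)) (hl : l.Nodup) {X : Fin 12 → SignType}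
    (hX : ∀ e, X e = 0 ↔ e ∈ l) : (cells T l).testBit (posMask X) ↔
      ∀ Y : Fin 12 → SignType, (∀ e, Y e ≠ 0) → Conf X Y → T.testBit (posMask Y) := by
  induction l generalizing X with
  | nil =>
    simp only [List.not_mem_nil, iff_false] at hX
    refine ⟨fun h Y _ hXY => ?_, fun h => h X hX fun e => Or.inr rfl⟩
    rwa [← funext fun e => (hXY e).resolve_left (hX e)]
  | cons a l ih =>
    have ha : X a = 0 := (hX a).2 (by simp)
    have hz : ∀ s : SignType, s ≠ 0 → ∀ e, Function.update X a s e = 0 ↔ e ∈ l := by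
      intro s hs e
      by_cases he : e = a
      · subst he
        simp [hs, (List.nodup_cons.1 hl).1]
      · rw [Function.update_of_ne he, hX, List.mem_cons]
        simp [he]
    have hconf : ∀ Y : Fin 12 → SignType, Conf X Y → Conf (Function.update X a (Y a)) Y := by
      intro Y hY e
      by_cases he : e = a
      · subst he; simp
      · rw [Function.update_of_ne he]; exact hY e
    have hconf' : ∀ (Y : Fin 12 → SignType) (s : SignType), Conf (Function.update X a s) Y →
        Conf X Y := by
      intro Y s hY e
      by_cases he : e = a
      · subst he; exact Or.inl ha
      · have := hY e
        rwa [Function.update_of_ne he] at this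
    rw [cells, testBit_contract ha, Bool.and_eq_true,
      ih (List.nodup_cons.1 hl).2 (hz (-1) (by decide)),
      ih (List.nodup_cons.1 hl).2 (hz 1 (by decide))]
    refine ⟨fun h Y hY hXY => ?_, fun h => ⟨fun Y hY hXY => h Y hY (hconf' Y _ hXY),
      fun Y hY hXY => h Y hY (hconf' Y _ hXY)⟩⟩
    have h3 := hconf Y hXY
    rcases (Y a).trichotomy with h' | h' | h'
    · rw [h'] at h3; exact h.1 Y hY h3
    · exact absurd h' (hY a)
    · rw [h'] at h3; exact h.2 Y hY h3

/-- The zeros of a sign vector in increasing order. -/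
def zeros (X : Fin 12 → SignType) : List (Fin 12) :=
  (List.finRange 12).filter fun e => X e = 0

lemma mem_zeros {X : Fin 12 → SignType} {e : Fin 12} : e ∈ zeros X ↔ X e = 0 := by
  simp [zeros]

lemma zeros_sublist (X : Fin 12 → SignType) : (zeros X).Sublist (List.finRange 12) :=
  List.filter_sublist

lemma nodup_zeros (X : Fin 12 → SignType) : (zeros X).Nodup :=
  (List.nodup_finRange 12).filter _

lemma isCell_iff {T : ℕ} {X : Fin 12 → SignType} :
    IsCell T X ↔ (∀ e, X e = 0) ∨ (cells T (zeros X)).testBit (posMask X) := by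
  rw [IsCell, testBit_cells_iff _ (nodup_zeros X) fun e => mem_zeros.symm]

lemma IsCell.of_conf {T : ℕ} {X Y : Fin 12 → SignType} (hX : IsCell T X) {e : Fin 12}
    (he : X e ≠ 0) (h : Conf X Y) : IsCell T Y :=
  Or.inr fun Z hZ hYZ => hX.resolve_left (fun h0 => he (h0 e)) Z hZ (h.trans hYZ)

/-- Every full refinement of the vector with `a` zeroed chooses one of the two signs at `a`, and so
refines one of the two given cells. -/
lemma IsCell.of_update {T : ℕ} {X : Fin 12 → SignType} (hX : IsCell T X) {a b : Fin 12}
    (hab : b ≠ a) (ha : X a ≠ 0) (hb : X b ≠ 0) (h : IsCell T (Function.update X a (-X a))) :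
    IsCell T (Function.update X a 0) := by
  refine Or.inr fun Y hY hXY => ?_
  have hY' : Y a = X a ∨ Y a = -X a := by
    have := hY a
    clear hXY h
    generalize Y a = y at *
    generalize X a = x at *
    revert x y
    decide
  rcases hY' with h' | h'
  · refine hX.resolve_left (fun h0 => ha (h0 a)) Y hY fun e => ?_
    by_cases he : e = a
    · subst he; exact Or.inr h'.symm
    · have := hXY e
      rwa [Function.update_of_ne he] at this
  · refine h.resolve_left (fun h0 => hb ?_) Y hY fun e => ?_
    · have := h0 b
      rwa [Function.update_of_ne hab] at this
    · by_cases he : e = a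
      · subst he; right; simp [h']
      · have := hXY e
        rw [Function.update_of_ne he] at this ⊢
        exact this

/-- The masks that contain `a` if `b` is true and do not contain `a` otherwise. -/
def half (a : ℕ) (b : Bool) : ℕ := if b then (2 ^ 4096 - 1) ^^^ lowerHalf a else lowerHalf a

lemma testBit_half {a m : ℕ} (ha : a < 12) (hm : m < 4096) (b : Bool) :
    (half a b).testBit m = (m.testBit a == b) := by
  cases b
  · simp [half, testBit_lowerHalf ha hm]
  · rw [half, if_pos rfl, Nat.testBit_xor, Nat.testBit_two_pow_sub_one, testBit_lowerHalf ha hm,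
      decide_eq_true hm]
    simp

/-- Apply `f` to a natural number after evaluating it. -/
def eager {α : Sort*} (f : ℕ → α) : ℕ → α
  | 0 => f 0
  | n + 1 => f (n + 1)

lemma eager_eq {α : Sort*} (f : ℕ → α) (n : ℕ) : eager f n = f n := by
  cases n <;> rfl

/-- The members of `C` that agree with `m` at all `g ∈ l'` outside `l` whose flip in `m` stays
in `C`. -/
def agreeing (C : ℕ) (l : List (Fin 12)) (m : ℕ) : List (Fin 12) → ℕ
  | [] => C
  | g :: l' => if !l.contains g && C.testBit (m ^^^ 2 ^ (g : ℕ)) then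
      agreeing C l m l' &&& half g (m.testBit g) else agreeing C l m l'

lemma testBit_agreeing {C : ℕ} {l : List (Fin 12)} {m m' : ℕ} (hm' : m' < 4096)
    (hC : C.testBit m') (l' : List (Fin 12))
    (h : ∀ g : Fin 12, g ∉ l → C.testBit (m ^^^ 2 ^ (g : ℕ)) → m'.testBit g = m.testBit g) :
    (agreeing C l m l').testBit m' := by
  induction l' with
  | nil => exact hC
  | cons g l' ih =>
    rw [agreeing]
    split_ifs with h'
    · simp only [Bool.and_eq_true, Bool.not_eq_true', List.contains_eq_mem,
        decide_eq_false_iff_not] at h'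
      rw [Nat.testBit_and, ih, testBit_half g.2 hm', h g h'.1 h'.2]
      simp
    · exact ih

/-- The set bits of `C`, shifted by `s`, if `C` is below `2 ^ 2 ^ k`. -/
def bits : ℕ → ℕ → ℕ → List ℕ
  | _, 0, _ => []
  | 0, _ + 1, s => [s]
  | k + 1, C + 1, s => bits k ((C + 1) % 2 ^ 2 ^ k) s ++ bits k ((C + 1) >>> 2 ^ k) (s + 2 ^ k)

lemma mem_bits {m : ℕ} (k : ℕ) : ∀ C s, m < 2 ^ k → C.testBit m → s + m ∈ bits k C s := by
  induction k generalizing m with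
  | zero =>
    intro C s hm h
    obtain rfl : m = 0 := by simpa using hm
    cases C with
    | zero => simp at h
    | succ C => simp [bits]
  | succ k ih =>
    intro C s hm h
    cases C with
    | zero => simp at h
    | succ C =>
      rw [bits, List.mem_append]
      rcases lt_or_ge m (2 ^ k) with hlt | hge
      · left
        refine ih _ _ hlt ?_
        rw [Nat.testBit_mod_two_pow, h]
        simpa using hlt
      · right
        rw [pow_succ] at hm
        have := ih (m := m - 2 ^ k) ((C + 1) >>> 2 ^ k) (s + 2 ^ k) (by omega) (by
          rw [Nat.testBit_shiftRight, Nat.add_sub_cancel' hge, h])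
        rwa [add_assoc, Nat.add_sub_cancel' hge] at this

lemma posMask_mem_bits {C : ℕ} {X : Fin 12 → SignType} (h : C.testBit (posMask X)) :
    posMask X ∈ bits 12 C 0 := by
  simpa using mem_bits 12 C 0 (posMask_lt X) h

/-! ### Uniform oriented matroids of rank 4 from their topes -/

/-- The bitmap `T` describes the topes of a uniform oriented matroid of rank 4. -/
structure IsUniform (T : ℕ) : Prop where
  lt : T < 2 ^ 2 ^ 12
  symm : ∀ m ∈ bits 12 T 0, T.testBit (4095 - m)
  -- A cell is determined by its walls: `m` is the only member of `C` with its signs at the elements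
  -- whose reversal in `m` gives another member. Zero sets of size three are left to `vertex`.
  rigid : ∀ k < 3, ∀ l ∈ (List.finRange 12).sublistsLen k,
    eager (α := Bool) (fun C => (bits 12 C 0).all (eager fun m =>
      agreeing C l m (List.finRange 12) == 2 ^ m)) (cells T l)
  vertex : ∀ l ∈ (List.finRange 12).sublistsLen 3, (bits 12 (cells T l) 0).length = 2
  generic : ∀ l ∈ (List.finRange 12).sublistsLen 4, cells T l = 0

lemma posMask_flip {X : Fin 12 → SignType} {g : Fin 12} (hg : X g ≠ 0) :
    posMask (Function.update X g (-X g)) = posMask X ^^^ 2 ^ (g : ℕ) := by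
  refine Nat.eq_of_testBit_eq fun i => ?_
  rw [Nat.testBit_xor, Nat.testBit_two_pow]
  by_cases hi : i < 12
  · obtain ⟨e, rfl⟩ : ∃ e : Fin 12, (e : ℕ) = i := ⟨⟨i, hi⟩, rfl⟩
    rw [testBit_posMask, testBit_posMask]
    by_cases he : e = g
    · subst he
      simp only [Function.update_self, decide_true, Bool.xor_true]
      generalize X e = x at *
      revert x
      decide
    · rw [Function.update_of_ne he]
      have : (g : ℕ) ≠ e := fun h => he (Fin.ext h.symm)
      simp [this]
  · have h2 : (g : ℕ) ≠ i := by omega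
    rw [Nat.testBit_lt_two_pow ((posMask_lt _).trans_le
        (Nat.pow_le_pow_right (n := 2) (i := 12) (by norm_num) (by omega))),
      Nat.testBit_lt_two_pow ((posMask_lt _).trans_le
        (Nat.pow_le_pow_right (n := 2) (i := 12) (by norm_num) (by omega)))]
    simp [h2]

lemma posMask_neg {X : Fin 12 → SignType} (h : ∀ e, X e ≠ 0) :
    posMask (fun e => -X e) = 4095 - posMask X := by
  have h1 : posMask (fun e => -X e) + posMask X = 4095 := by
    unfold posMask
    rw [← Finset.sum_add_distrib]
    have : ∀ e : Fin 12, ((if -X e = 1 then 2 ^ (e : ℕ) else 0) +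
        if X e = 1 then 2 ^ (e : ℕ) else 0) = 2 ^ (e : ℕ) := by
      intro e
      have := h e
      generalize X e = x at *
      revert x
      generalize 2 ^ (e : ℕ) = y
      intro x
      cases x <;> simp [SignType.neg_eq_neg_one, SignType.zero_eq_zero, SignType.pos_eq_one]
    rw [Finset.sum_congr rfl fun e _ => this e]
    decide
  omega

namespace IsUniform

variable {T : ℕ}

lemma neg (hT : IsUniform T) {X : Fin 12 → SignType} (hX : IsCell T X) :
    IsCell T fun e => -X e := by
  rcases hX with h | h
  · exact Or.inl fun e => by simp [h e]
  refine Or.inr fun Y hY hXY => ?_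
  have h1 := h (fun e => -Y e) (fun e => by simpa using hY e) fun e => by
    rcases hXY e with h' | h'
    · left; simpa using h'
    · right; show X e = -Y e; rw [← h', neg_neg]
  have h2 := hT.symm _ (posMask_mem_bits h1)
  have hlt := posMask_lt Y
  rwa [posMask_neg hY, Nat.sub_sub_self (by omega)] at h2

/-- A nonzero cell with more than four zeros refines to one with exactly four, by making the other
zeros positive, and `generic` excludes that. -/
lemma eq_zero_of_four_zeros (hT : IsUniform T) {X : Fin 12 → SignType} (hX : IsCell T X)
    (h : 4 ≤ (zeros X).length) : ∀ e, X e = 0 := by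
  by_contra hne
  push Not at hne
  obtain ⟨e₀, he₀⟩ := hne
  set l := (zeros X).take 4 with hl
  have hsub : l.Sublist (zeros X) := List.take_sublist _ _
  have hlen : l.length = 4 := by simp [hl, h]
  set Y : Fin 12 → SignType := fun e => if e ∈ l then 0 else if X e = 0 then 1 else X e with hY
  have hY0 : ∀ e, Y e = 0 ↔ e ∈ l := by
    intro e
    simp only [hY]
    split_ifs with h1 h2
    · simp [h1]
    · simp [h1]
    · simp [h1, h2]
  have hcell : IsCell T Y := hX.of_conf he₀ fun e => by
    by_cases h1 : X e = 0
    · exact Or.inl h1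
    · right
      have : e ∉ l := fun h' => h1 (mem_zeros.1 (hsub.subset h'))
      simp [hY, h1, this]
  have hYe : Y e₀ ≠ 0 := by
    rw [Ne, hY0]
    exact fun h' => he₀ (mem_zeros.1 (hsub.subset h'))
  have h1 := (testBit_cells_iff (T := T) l ((nodup_zeros X).sublist hsub) hY0).2
    (hcell.resolve_left fun h => hYe (h e₀))
  rw [hT.generic l (List.mem_sublistsLen.2 ⟨hsub.trans (zeros_sublist X), hlen⟩)] at h1
  simp at h1

/-- By `vertex` only two masks are available for this zero set, and `X` and its negative already use
both. -/
lemma eq_or_eq_neg (hT : IsUniform T) {X Y : Fin 12 → SignType} (hX : IsCell T X)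
    (hY : IsCell T Y) (h0 : ∀ e, X e = 0 ↔ Y e = 0) (hlen : (zeros X).length = 3) :
    Y = X ∨ Y = fun e => -X e := by
  obtain ⟨e₀, he₀⟩ : ∃ e, X e ≠ 0 := by
    by_contra hcon
    push Not at hcon
    simp [zeros, hcon] at hlen
  have hmem : ∀ {Z : Fin 12 → SignType}, IsCell T Z → (∀ e, X e = 0 ↔ Z e = 0) →
      posMask Z ∈ bits 12 (cells T (zeros X)) 0 := by
    intro Z hZ hXZ
    have hz : zeros Z = zeros X := List.filter_congr fun e _ => by simp [hXZ e]
    rw [← hz]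
    exact posMask_mem_bits ((isCell_iff.1 hZ).resolve_left fun h => he₀ ((hXZ _).2 (h e₀)))
  obtain ⟨m, m', hv⟩ := List.length_eq_two.1
    (hT.vertex (zeros X) (List.mem_sublistsLen.2 ⟨zeros_sublist X, hlen⟩))
  have h1 := hmem hX fun e => Iff.rfl
  have h2 := hmem hY h0
  have h3 := hmem (hT.neg hX) fun e => by simp
  simp only [hv, List.mem_cons, List.not_mem_nil, or_false] at h1 h2 h3
  have h4 : posMask X ≠ posMask fun e => -X e := fun h => by
    have := congrFun (eq_of_posMask_eq h fun e => by simp) e₀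
    clear * - this he₀
    generalize X e₀ = x at *
    revert x
    decide
  by_cases h5 : posMask Y = posMask X
  · exact Or.inl (eq_of_posMask_eq h5 fun e => (h0 e).symm)
  · exact Or.inr (eq_of_posMask_eq (by omega) fun e => by simp [h0 e])

/-- Since `Y c ≠ 0`, the cell `Y` has at most three zeros, so its zero set is that of `X`; one
common sign then excludes the opposite vertex. -/
lemma eq_of_zeros_subset (hT : IsUniform T) {X Y : Fin 12 → SignType} (hX : IsCell T X)
    (hY : IsCell T Y) (hlen : (zeros X).length = 3) (h0 : ∀ e, X e = 0 → Y e = 0) {c : Fin 12}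
    (hc : X c ≠ 0) (hXY : Y c = X c) : Y = X := by
  have hsub : (zeros X).Sublist (zeros Y) := List.monotone_filter_right _ fun e he => by
    simpa using h0 e (by simpa using he)
  have hz : zeros X = zeros Y := hsub.eq_of_length_le <| by
    by_contra hcon
    exact hc (hXY ▸ hT.eq_zero_of_four_zeros hY (by omega) c)
  rcases hT.eq_or_eq_neg hX hY (fun e => by rw [← mem_zeros, hz, mem_zeros]) hlen with h | h
  · exact h
  · exfalso
    rw [congrFun h c] at hXY
    clear * - hXY hc
    generalize X c = x at *
    revert x
    decide

/-- By `rigid`, a cell `Y` that agrees with `X` at every wall of `X` is `X` itself, so some wall of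
`X` separates them. With three zeros only `X` and its negative exist, and both are excluded. -/
lemma exists_flip (hT : IsUniform T) {X Y : Fin 12 → SignType} (hX : IsCell T X)
    (hY : IsCell T Y) (h0 : ∀ e, X e = 0 ↔ Y e = 0) (hne : X ≠ Y) (hne' : Y ≠ fun e => -X e) :
    ∃ g, Separates X Y g ∧ IsCell T (Function.update X g (-X g)) := by
  have hzz : zeros Y = zeros X := by
    unfold zeros
    refine List.filter_congr fun e _ => ?_
    simp [h0 e]
  obtain ⟨e₀, he₀⟩ : ∃ e, X e ≠ 0 := by
    by_contra hcon
    push Not at hcon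
    exact hne (funext fun e => by rw [hcon e, (h0 e).1 (hcon e)])
  have hXl : (cells T (zeros X)).testBit (posMask X) :=
    (isCell_iff.1 hX).resolve_left fun h => he₀ (h e₀)
  have hYl : (cells T (zeros X)).testBit (posMask Y) := by
    rw [← hzz]
    exact (isCell_iff.1 hY).resolve_left fun h => he₀ ((h0 _).2 (h e₀))
  have hlen : (zeros X).length < 4 := by
    by_contra hcon
    exact he₀ (hT.eq_zero_of_four_zeros hX (not_lt.1 hcon) e₀)
  rcases Nat.lt_succ_iff_lt_or_eq.1 hlen with hlen | hlen
  · by_contra hcon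
    push Not at hcon
    have h1 := hT.rigid _ hlen (zeros X) (List.mem_sublistsLen.2 ⟨zeros_sublist X, rfl⟩)

    rw [eager_eq, List.all_eq_true] at h1
    replace h1 := h1 _ (posMask_mem_bits hXl)
    rw [eager_eq, beq_iff_eq] at h1
    have h2 := testBit_agreeing (l := zeros X) (m := posMask X) (posMask_lt Y) hYl
      (List.finRange 12) fun g hg hflip => by
        rw [mem_zeros] at hg
        rw [← posMask_flip hg] at hflip
        have hz : zeros (Function.update X g (-X g)) = zeros X := by
          unfold zeros
          refine List.filter_congr fun e _ => ?_
          by_cases he : e = g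
          · subst he; simp
          · rw [Function.update_of_ne he]
        have h3 : ¬ Separates X Y g := fun hs => hcon g hs
          (isCell_iff.2 (Or.inr (by rw [hz]; exact hflip)))
        rw [testBit_posMask, testBit_posMask]
        have h4 := h0 g
        unfold Separates at h3
        clear hflip hz hcon h1
        generalize X g = x at *
        generalize Y g = y at *
        revert x y
        decide
    rw [h1, Nat.testBit_two_pow] at h2
    exact hne (eq_of_posMask_eq (by simpa using h2) h0)
  · exact ((hT.eq_or_eq_neg hX hY h0 hlen).elim (fun h => hne h.symm) hne').elim

/-- Walk from `X` towards `Y`, each time crossing a wall that separates the current cell from `Y`,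
so that only separated entries ever change. When the wall is `e`, zeroing it gives `Z`. For opposite
cells the zero vector works. -/
lemma elim_of_same_zeros (hT : IsUniform T) {Y : Fin 12 → SignType} (hY : IsCell T Y)
    {e : Fin 12} (n : ℕ) : ∀ X : Fin 12 → SignType, IsCell T X → (∀ e, X e = 0 ↔ Y e = 0) →
    Separates X Y e → (Finset.univ.filter fun g => X g ≠ Y g).card = n →
    ∃ Z, IsCell T Z ∧ Z e = 0 ∧ ∀ f, ¬ Separates X Y f → Z f = X f := by
  induction n using Nat.strong_induction_on with
  | _ n ih =>
    intro X hX h0 he hn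
    by_cases hneg : Y = fun e => -X e
    · refine ⟨fun _ => 0, Or.inl fun _ => rfl, rfl, fun f hf => ?_⟩
      by_contra hne
      exact hf ⟨Ne.symm hne, by rw [hneg]⟩
    have hne : X ≠ Y := by
      rintro rfl
      have := he.1
      have h2 := he.2
      generalize X e = x at *
      revert x
      decide
    obtain ⟨g, hg, hflip⟩ := hT.exists_flip hX hY h0 hne hneg
    by_cases hge : g = e
    · subst hge
      obtain ⟨b, hb, hbg⟩ : ∃ b, X b ≠ 0 ∧ b ≠ g := by
        by_contra hcon
        push Not at hcon
        refine hneg (funext fun b => ?_)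
        by_cases hb : X b = 0
        · rw [(h0 b).1 hb, hb]; rfl
        · rw [hcon b hb]; exact hg.2
      refine ⟨_, hX.of_update hbg hg.1 hb hflip, by simp, fun f hf => ?_⟩
      rw [Function.update_of_ne]
      rintro rfl
      exact hf hg
    · set X' := Function.update X g (-X g) with hX'
      have hX'g : X' g = Y g := by rw [hX', Function.update_self, hg.2]
      have hX'f : ∀ f, f ≠ g → X' f = X f := fun f hf => Function.update_of_ne hf _ _
      have hlt : (Finset.univ.filter fun f => X' f ≠ Y f).card < n := by
        rw [← hn]
        refine Finset.card_lt_card (Finset.ssubset_iff_of_subset (fun f hf => ?_) |>.2 ⟨g, ?_, ?_⟩)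
        · simp only [Finset.mem_filter, Finset.mem_univ, true_and] at hf ⊢
          by_cases hfg : f = g
          · subst hfg; exact absurd hX'g hf
          · rwa [hX'f f hfg] at hf
        · simp only [Finset.mem_filter, Finset.mem_univ, true_and]
          intro h
          have h1 := hg.1
          have h2 := hg.2
          rw [← h] at h2
          generalize X g = x at h1 h2
          clear * - h1 h2
          revert x
          decide
        · simp [hX'g]
      obtain ⟨Z, hZ, hZe, hZf⟩ := ih _ hlt X' hflip (fun f => by
        by_cases hf : f = g
        · subst hf; rw [hX'g]
        · rw [hX'f f hf, h0]) (by
        unfold Separates; rw [hX'f e (Ne.symm hge)]; exact he) rfl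
      refine ⟨Z, hZ, hZe, fun f hf => ?_⟩
      have hfg : f ≠ g := by rintro rfl; exact hf hg
      rw [hZf f (by unfold Separates; rw [hX'f f hfg]; exact hf), hX'f f hfg]

/-- The oriented matroid whose topes are given by a bitmap. -/
def toOrientedMatroid (hT : IsUniform T) : OrientedMatroid (Fin 12) where
  covectors := {X | IsCell T X}
  zero_mem := Or.inl fun _ => rfl
  neg_mem X hX := hT.neg hX
  comp_mem X hX Y hY := by
    by_cases h : ∀ e, X e = 0
    · have : comp X Y = Y := funext fun e => by simp [comp, h e]
      rwa [this]
    · push Not at h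
      obtain ⟨e, he⟩ := h
      refine hX.of_conf he fun f => ?_
      by_cases hf : X f = 0
      · exact Or.inl hf
      · exact Or.inr (by simp [comp, hf])
  elim X hX Y hY e he := by
    have hXe := he.1
    have hYe : Y e ≠ 0 := by rw [he.2]; simpa using hXe
    have hc : ∀ {X Y : Fin 12 → SignType}, IsCell T X → X e ≠ 0 → IsCell T (comp X Y) := by
      intro X Y hX hXe
      refine hX.of_conf hXe fun f => ?_
      by_cases hf : X f = 0
      · exact Or.inl hf
      · exact Or.inr (by simp [comp, hf])
    have hs : ∀ f, Separates (comp X Y) (comp Y X) f ↔ Separates X Y f := by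
      intro f
      unfold Separates comp
      generalize X f = x
      generalize Y f = y
      revert x y
      decide
    -- The two compositions of `X` and `Y` have the same zeros as each other and the same separating
    -- elements as `X` and `Y`, which reduces elimination to equal zero sets.
    obtain ⟨Z, hZ, hZe, hZf⟩ := hT.elim_of_same_zeros (hc (Y := X) hY hYe) _ (comp X Y)
      (hc hX hXe) (fun f => by rw [comp_eq_zero_iff, comp_eq_zero_iff, and_comm])
      ((hs e).2 he) rfl
    exact ⟨Z, hZ, hZe, fun f hf => hZf f fun h => hf ((hs f).1 h)⟩

end IsUniform

/-! ### Decoding masks, and the rank -/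

lemma bits_spec {m : ℕ} (k : ℕ) : ∀ C s, C < 2 ^ 2 ^ k → m ∈ bits k C s →
    ∃ i < 2 ^ k, m = s + i ∧ C.testBit i := by
  induction k with
  | zero =>
    intro C s hC hm
    cases C with
    | zero => simp [bits] at hm
    | succ C =>
      obtain rfl : C = 0 := by simpa using hC
      exact ⟨0, by simp, by simpa [bits] using hm, by simp⟩
  | succ k ih =>
    intro C s hC hm
    cases C with
    | zero => simp [bits] at hm
    | succ C =>
      rw [bits, List.mem_append] at hm
      rcases hm with hm | hm
      · obtain ⟨i, hi, rfl, h⟩ := ih _ _ (Nat.mod_lt _ (by positivity)) hm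
        rw [Nat.testBit_mod_two_pow, Bool.and_eq_true] at h
        exact ⟨i, hi.trans (Nat.pow_lt_pow_right (by norm_num) (by omega)), rfl, h.2⟩
      · obtain ⟨i, hi, rfl, h⟩ := ih _ _ (by
          rw [Nat.shiftRight_eq_div_pow, Nat.div_lt_iff_lt_mul (by positivity), ← pow_add]
          rwa [pow_succ, mul_two] at hC) hm
        rw [Nat.testBit_shiftRight] at h
        exact ⟨2 ^ k + i, by rw [pow_succ]; omega, by ring, h⟩

lemma cells_le (T : ℕ) (l : List (Fin 12)) : cells T l ≤ T := by
  induction l with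
  | nil => exact le_rfl
  | cons a l ih => exact (Nat.and_le_left.trans Nat.and_le_left).trans ih

/-- The sign vector with zero set `l` and with the bits of `m` as positive elements. -/
def decode (l : List (Fin 12)) (m : ℕ) : Fin 12 → SignType :=
  fun e => if e ∈ l then 0 else if m.testBit e then 1 else -1

lemma decode_eq_zero_iff {l : List (Fin 12)} {m : ℕ} {e : Fin 12} :
    decode l m e = 0 ↔ e ∈ l := by
  unfold decode
  split_ifs <;> simp [*]

lemma decode_eq_iff {l l' : List (Fin 12)} {m m' : ℕ} {e : Fin 12} (h : e ∉ l) (h' : e ∉ l') :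
    decode l m e = decode l' m' e ↔ m.testBit e = m'.testBit e := by
  unfold decode
  rw [if_neg h, if_neg h']
  cases m.testBit e <;> cases m'.testBit e <;> simp

lemma decode_eq_neg_iff {l l' : List (Fin 12)} {m m' : ℕ} {e : Fin 12} (h : e ∉ l)
    (h' : e ∉ l') : decode l m e = -decode l' m' e ↔ m.testBit e ≠ m'.testBit e := by
  unfold decode
  rw [if_neg h, if_neg h']
  cases m.testBit e <;> cases m'.testBit e <;> simp

lemma not_testBit_of_mem {T m : ℕ} (hm : m < 4096) (l : List (Fin 12))
    (h : (cells T l).testBit m) : ∀ e ∈ l, m.testBit e = false := by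
  induction l with
  | nil => simp
  | cons a l ih =>
    rw [cells, contract, Nat.testBit_and, Nat.testBit_and, testBit_lowerHalf a.2 hm] at h
    simp only [Bool.and_eq_true, Bool.not_eq_true'] at h
    simp only [List.mem_cons, forall_eq_or_imp]
    exact ⟨h.2, ih h.1.1⟩

lemma isCell_decode {T m : ℕ} (hm : m < 4096) {l : List (Fin 12)} (hl : l.Nodup)
    (h : (cells T l).testBit m) : IsCell T (decode l m) := by
  have hp : posMask (decode l m) = m := by
    rw [posMask_eq_ofBits]
    have : (fun e : Fin 12 => decide (decode l m e = 1)) = fun e : Fin 12 => m.testBit e := by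
      funext e
      unfold decode
      by_cases he : e ∈ l
      · simp [he, not_testBit_of_mem hm l h e he]
      · simp only [he, if_false]
        cases m.testBit e <;> simp
    rw [this, Nat.ofBits_testBit]
    exact Nat.mod_eq_of_lt hm
  rw [← hp] at h
  exact Or.inr ((testBit_cells_iff l hl fun e => decode_eq_zero_iff).1 h)

lemma conf_decode {l l' : List (Fin 12)} (h : l' ⊆ l) (m : ℕ) :
    Conf (decode l m) (decode l' m) := by
  intro e
  by_cases he : e ∈ l
  · exact Or.inl (decode_eq_zero_iff.2 he)
  · exact Or.inr ((decode_eq_iff he fun h' => he (h h')).2 rfl)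

namespace IsUniform

variable {T : ℕ}

lemma isCell_decode_getD (hT : IsUniform T) {l : List (Fin 12)}
    (hl : l.Sublist (List.finRange 12)) (hlen : l.length = 3) {s : ℕ} (hs : s < 2) :
    IsCell T (decode l ((bits 12 (cells T l) 0).getD s 0)) := by
  have h2 := hT.vertex l (List.mem_sublistsLen.2 ⟨hl, hlen⟩)
  rw [List.getD_eq_getElem _ _ (by omega)]
  have hmem := List.getElem_mem (l := bits 12 (cells T l) 0) (n := s) (by omega)
  obtain ⟨i, hi, h, hbit⟩ := bits_spec 12 _ _ ((cells_le T l).trans_lt hT.lt) hmem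
  rw [h, zero_add]
  exact isCell_decode hi ((List.nodup_finRange 12).sublist hl) hbit

lemma hasRank_four (hT : IsUniform T) : hT.toOrientedMatroid.HasRank 4 := by
  constructor
  · refine OrientedMatroid.HasFlag.hasChain ?_
    set m := (bits 12 (cells T [0, 1, 2]) 0).getD 0 0
    have h3 : IsCell T (decode [0, 1, 2] m) := hT.isCell_decode_getD (by decide) rfl (by norm_num)
    have h9 : decode [0, 1, 2] m 9 ≠ 0 := fun h => by
      have := decode_eq_zero_iff.1 h
      revert this
      decide
    have hsub : ∀ {l : List (Fin 12)}, l ⊆ [0, 1, 2] → IsCell T (decode l m) := fun hl =>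
      h3.of_conf h9 (conf_decode hl m)
    refine ⟨fun i => match i with
      | 0 => fun _ => 0
      | 1 => decode [0, 1, 2] m
      | 2 => decode [0, 1] m
      | 3 => decode [0] m
      | _ => decode [] m, fun i hi => ?_, fun i hi => ?_⟩
    · interval_cases i
      · exact Or.inl fun _ => rfl
      · exact h3
      · exact hsub (by decide)
      · exact hsub (by decide)
      · exact hsub (by decide)
    · interval_cases i
      · exact ⟨fun e _ => rfl, 9, rfl, h9⟩
      all_goals simp only [decode_eq_zero_iff, ne_eq]; decide
  · rintro k hk
    obtain ⟨X, hX, hlt⟩ := OrientedMatroid.hasChain_iff_hasFlag.1 hk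
    -- The first nonzero support leaves at most three zeros, and each further step of the flag
    -- removes at least one.
    have hcard : ∀ i, i < k →
        (Finset.univ.filter fun e => X (i + 1) e = 0).card + (i + 1) ≤ 4 := by
      intro i
      induction i with
      | zero =>
        intro hi
        obtain ⟨-, e, -, he⟩ := hlt 0 hi
        have h4 : (zeros (X 1)).length < 4 := by
          by_contra hcon
          exact he (hT.eq_zero_of_four_zeros (hX 1 hi) (not_lt.1 hcon) e)
        have : (Finset.univ.filter fun e => X 1 e = 0).card = (zeros (X 1)).length := by
          rw [← List.toFinset_card_of_nodup (nodup_zeros _)]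
          congr 1
          ext e
          simp [mem_zeros]
        simp only [zero_add]
        omega
      | succ i ih =>
        intro hi
        obtain ⟨h1, e, h2, h3⟩ := hlt (i + 1) hi
        have := Finset.card_lt_card (s := Finset.univ.filter fun e => X (i + 1 + 1) e = 0)
          (t := Finset.univ.filter fun e => X (i + 1) e = 0)
          ((Finset.ssubset_iff_of_subset fun f hf => by
            simp only [Finset.mem_filter, Finset.mem_univ, true_and] at hf ⊢
            exact h1 f hf).2 ⟨e, by simpa using h2, by simpa using h3⟩)
        have := ih (by omega)
        omega
    by_contra hcon
    have := hcard 4 (not_le.1 hcon)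
    omega

end IsUniform

end TopeBitmap

/-! ### Signs of a new element at the vertices -/

namespace OrientedMatroid

variable {E : Type*}

/-- If a covector is supported on `none` alone, the flag can be prolonged by a first step from zero
to that covector. A coloop thus raises the rank. -/
lemma HasFlag.succ_of_restrict {M' : OrientedMatroid (Option E)} {k : ℕ}
    (h : (M'.restrict Function.Embedding.some).HasFlag k) {X : Option E → SignType}
    (hX : X ∈ M'.covectors) (h0 : ∀ e, X (some e) = 0) (hne : X none ≠ 0) :
    M'.HasFlag (k + 1) := by
  obtain ⟨F, hF, hlt⟩ := h
  have hF' : ∀ i, ∃ Y ∈ M'.covectors, i ≤ k → F i = fun e => Y (some e) := by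
    intro i
    by_cases hi : i ≤ k
    · obtain ⟨Y, hY, h⟩ := hF i hi
      exact ⟨Y, hY, fun _ => h⟩
    · exact ⟨X, hX, fun h => absurd h hi⟩
  choose Y hY hFY using hF'
  refine ⟨fun i => match i with
    | 0 => fun _ => 0
    | i + 1 => comp X (Y i), fun i hi => ?_, fun i hi => ?_⟩
  · cases i with
    | zero => exact M'.zero_mem
    | succ i => exact M'.comp_mem _ hX _ (hY i)
  · cases i with
    | zero => exact ⟨fun _ _ => rfl, none, rfl, fun h => hne (comp_eq_zero_iff.1 h).1⟩
    | succ i =>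
      obtain ⟨h1, e, h2, h3⟩ := hlt i (by omega)
      rw [hFY i (by omega), hFY (i + 1) (by omega)] at *
      refine ⟨fun f hf => ?_, some e, ?_, ?_⟩
      · rw [comp_eq_zero_iff] at hf ⊢
        cases f with
        | none => exact absurd hf.1 hne
        | some f => exact ⟨hf.1, h1 f hf.2⟩
      · exact comp_eq_zero_iff.2 ⟨h0 e, h2⟩
      · exact fun h => h3 (comp_eq_zero_iff.1 h).2

/-- Eliminate the elements of `B` one after the other from `X`. -/
lemma exists_eliminate {M' : OrientedMatroid (Option E)} {B : Finset E} {s : SignType}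
    {X : Option E → SignType} (hX : X ∈ M'.covectors) (hXs : X none = 0 ∨ X none = s)
    {Y : E → Option E → SignType} (hY : ∀ b ∈ B, X (some b) ≠ 0 → Y b ∈ M'.covectors ∧
      Y b (some b) = -X (some b) ∧ (∀ b' ∈ B, b' ≠ b → Y b (some b') = 0) ∧
      (Y b none = 0 ∨ Y b none = s)) :
    ∃ Z ∈ M'.covectors, (∀ b ∈ B, Z (some b) = 0) ∧
      (Z none = 0 → X none = 0 ∧ ∀ b ∈ B, X (some b) ≠ 0 → Y b none = 0) := by
  classical
  suffices ∀ S ⊆ B, ∃ Z ∈ M'.covectors, (∀ b ∈ S, Z (some b) = 0) ∧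
      (∀ b ∈ B \ S, Z (some b) = X (some b)) ∧ (Z none = 0 ∨ Z none = s) ∧
      (Z none = 0 → X none = 0 ∧ ∀ b ∈ S, X (some b) ≠ 0 → Y b none = 0) by
    obtain ⟨Z, h1, h2, -, -, h3⟩ := this B subset_rfl
    exact ⟨Z, h1, h2, h3⟩
  intro S
  induction S using Finset.induction_on with
  | empty => exact fun _ => ⟨X, hX, by simp, by simp, hXs, fun h => ⟨h, by simp⟩⟩
  | insert b S hb ih =>
    intro hS
    have hbB : b ∈ B := hS (Finset.mem_insert_self b S)
    obtain ⟨Z, hZ, hZS, hZB, hZs, hZ0⟩ := ih fun _ h => hS (Finset.mem_insert_of_mem h)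
    have hZb : Z (some b) = X (some b) := hZB b (by simp [hbB, hb])
    by_cases hXb : X (some b) = 0
    · refine ⟨Z, hZ, ?_, fun c hc => hZB c ?_, hZs, fun h => ⟨(hZ0 h).1, ?_⟩⟩
      · simp only [Finset.mem_insert, forall_eq_or_imp]
        exact ⟨hZb.trans hXb, hZS⟩
      · simp only [Finset.mem_sdiff, Finset.mem_insert, not_or] at hc ⊢
        exact ⟨hc.1, hc.2.2⟩
      · simp only [Finset.mem_insert, forall_eq_or_imp]
        exact ⟨fun h' => absurd hXb h', (hZ0 h).2⟩
    · obtain ⟨hYb, hYbb, hY0, hYs⟩ := hY b hbB hXb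
      obtain ⟨W, hW, hWb, hWf⟩ := M'.elim Z hZ (Y b) hYb (some b) ⟨by rwa [hZb], by rw [hYbb, hZb]⟩
      have hWB : ∀ c ∈ B, c ≠ b → W (some c) = Z (some c) := by
        intro c hc hcb
        rw [hWf (some c) fun h => h.1 (by
          have := h.2
          rw [hY0 c hc hcb] at this
          simpa using this.symm)]
        unfold comp
        rw [hY0 c hc hcb]
        split_ifs with h
        · exact h.symm
        · rfl
      have hWn : W none = comp Z (Y b) none := hWf none fun h => by
        have h1 := h.1
        have h2 := h.2
        clear * - h1 h2 hZs hYs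
        generalize Z none = z at *
        generalize Y b none = y at *
        revert z y s
        decide
      refine ⟨W, hW, fun c hc => ?_, fun c hc => ?_, ?_, fun h => ?_⟩
      · rcases Finset.mem_insert.1 hc with rfl | hc'
        · exact hWb
        · rw [hWB c (hS hc) (by rintro rfl; exact hb hc'), hZS c hc']
      · simp only [Finset.mem_sdiff, Finset.mem_insert, not_or] at hc
        rw [hWB c hc.1 hc.2.1, hZB c (by simp [hc])]
      · rw [hWn]
        unfold comp
        split_ifs
        · exact hYs
        · exact hZs
      · rw [hWn, comp_eq_zero_iff] at h
        simp only [Finset.mem_insert, forall_eq_or_imp]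
        exact ⟨(hZ0 h.1).1, fun _ => h.2, (hZ0 h.1).2⟩

end OrientedMatroid

namespace TopeBitmap

open OrientedMatroid

/-- Some lift of the sign vector `W` to `M'` is positive on the new element. -/
def IsPos (M' : OrientedMatroid (Option (Fin 12))) (W : Fin 12 → SignType) : Prop :=
  ∃ X ∈ M'.covectors, X none = 1 ∧ ∀ e, X (some e) = W e

namespace IsUniform

variable {T : ℕ} {M' : OrientedMatroid (Option (Fin 12))}

lemma isCell_of_mem (hT : IsUniform T) (hM' : hT.toOrientedMatroid.IsOneElementExtension M')
    {X : Option (Fin 12) → SignType} (hX : X ∈ M'.covectors) : IsCell T fun e => X (some e) := by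
  have : (fun e => X (some e)) ∈ (M'.restrict Function.Embedding.some).covectors := ⟨X, hX, rfl⟩
  rwa [hM'.1] at this

lemma exists_lift (hT : IsUniform T) (hM' : hT.toOrientedMatroid.IsOneElementExtension M')
    {W : Fin 12 → SignType} (hW : IsCell T W) : ∃ X ∈ M'.covectors, ∀ e, X (some e) = W e := by
  have : W ∈ (M'.restrict Function.Embedding.some).covectors := by rw [hM'.1]; exact hW
  obtain ⟨X, hX, rfl⟩ := this
  exact ⟨X, hX, fun _ => rfl⟩

/-- Four zeros in a uniform matroid of rank four force all old entries to vanish; a nonzero entry at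
`none` would then raise the rank of `M'` to five. -/
lemma none_eq_zero (hT : IsUniform T) (hM' : hT.toOrientedMatroid.IsOneElementExtension M')
    {X : Option (Fin 12) → SignType} (hX : X ∈ M'.covectors) {B : Finset (Fin 12)}
    (hB : B.card = 4) (h0 : ∀ b ∈ B, X (some b) = 0) : X none = 0 := by
  have hE : ∀ e, X (some e) = 0 := hT.eq_zero_of_four_zeros (hT.isCell_of_mem hM' hX) <| by
    rw [← List.toFinset_card_of_nodup (nodup_zeros _), ← hB]
    exact Finset.card_le_card fun b hb => by simp [mem_zeros, h0 b hb]
  by_contra hne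
  obtain ⟨r, hr, hr'⟩ := hM'.2.2
  obtain rfl := hr.unique hT.hasRank_four
  have h4 := hT.hasRank_four.1
  rw [Set.mem_ofPred_eq, ← hM'.1, hasChain_iff_hasFlag] at h4
  have := hr'.2 (h4.succ_of_restrict hX hE hne).hasChain
  omega

/-- Eliminating an old element between positive lifts of `W` and its negative would leave a covector
with four old zeros that is still positive at `none`. -/
lemma not_isPos_neg (hT : IsUniform T) (hM' : hT.toOrientedMatroid.IsOneElementExtension M')
    {W : Fin 12 → SignType} (hW : (zeros W).length = 3) (h : IsPos M' W) :
    ¬ IsPos M' fun e => -W e := by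
  rintro ⟨Y, hY, hY1, hYW⟩
  obtain ⟨X, hX, hX1, hXW⟩ := h
  obtain ⟨c, hc⟩ : ∃ c, W c ≠ 0 := by
    by_contra hcon
    push Not at hcon
    simp [zeros, hcon] at hW
  obtain ⟨Z, hZ, hZc, hZf⟩ := M'.elim X hX Y hY (some c) ⟨by rwa [hXW], by rw [hXW, hYW]⟩
  have hZ1 : Z none = 1 := by
    rw [hZf none (by simp [Separates, hX1, hY1])]
    simp [comp, hX1]
  have := hT.none_eq_zero hM' hZ (B := insert c (zeros W).toFinset) (by
    rw [Finset.card_insert_of_notMem (by simpa [mem_zeros] using hc),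
      List.toFinset_card_of_nodup (nodup_zeros _), hW]) fun b hb => by
    rcases Finset.mem_insert.1 hb with rfl | hb
    · exact hZc
    · rw [List.mem_toFinset, mem_zeros] at hb
      rw [hZf (some b) (by simp [Separates, hXW, hb])]
      simp [comp, hXW, hYW, hb]
  rw [this] at hZ1
  exact absurd hZ1 (by decide)

/-- The line through the vertices `W₁` and `-W₂` contains the vertex `W₃` between them. -/
lemma isPos_of_line (hT : IsUniform T) (hM' : hT.toOrientedMatroid.IsOneElementExtension M')
    {W₁ W₂ W₃ : Fin 12 → SignType} (h₂ : IsCell T W₂) (h₃ : IsCell T W₃)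
    (hlen : (zeros W₃).length = 3) {c e : Fin 12}
    (h0 : ∀ f, W₃ f = 0 → f = e ∨ W₁ f = 0 ∧ W₂ f = 0) (he : W₁ e ≠ 0) (he' : W₂ e = W₁ e)
    (hc : W₁ c = 0) (hc₃ : W₃ c ≠ 0) (hc' : W₃ c = -W₂ c) (hpos : IsPos M' W₁) :
    IsPos M' W₂ ∨ IsPos M' W₃ := by
  by_contra hcon
  push Not at hcon
  obtain ⟨hn₂, hn₃⟩ := hcon
  obtain ⟨X, hX, hX1, hXW⟩ := hpos
  obtain ⟨Y, hY, hYW⟩ := hT.exists_lift hM' h₂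
  have hY1 : Y none ≠ 1 := fun h => hn₂ ⟨Y, hY, h, hYW⟩
  -- If the lift of `W₂` is not positive at `none`, its negative does not oppose `X` there, so
  -- eliminating `e` keeps `none` positive. The result has the zeros of `W₃` and its sign at `c`,
  -- hence lifts `W₃`.
  obtain ⟨Z, hZ, hZe, hZf⟩ := M'.elim X hX _ (M'.neg_mem Y hY) (some e)
    ⟨by rwa [hXW], by simp [hXW, hYW, he']⟩
  have hZ1 : Z none = 1 := by
    rw [hZf none (by
      simp only [Separates, hX1]
      clear * - hY1
      generalize Y none = y at *
      revert y
      decide)]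
    simp [comp, hX1]
  refine hn₃ ⟨Z, hZ, hZ1, fun f => congrFun (hT.eq_of_zeros_subset h₃ (hT.isCell_of_mem hM' hZ)
    hlen (fun f hf => ?_) hc₃ ?_) f⟩
  · rcases h0 f hf with rfl | ⟨h1, h2⟩
    · exact hZe
    · rw [hZf (some f) (by simp [Separates, hXW, h1])]
      simp [comp, hXW, hYW, h1, h2]
  · rw [hZf (some c) (by simp [Separates, hXW, hc])]
    simp [comp, hXW, hYW, hc, hc']

/-- Otherwise all corners lift with a zero at `none`. Using them to eliminate `B` from any covector
`X` does not lose a nonzero entry at `none`, so `X none = 0` by `none_eq_zero`, and the new element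
would be a loop. -/
lemma exists_isPos (hT : IsUniform T) (hM' : hT.toOrientedMatroid.IsOneElementExtension M')
    {B : Finset (Fin 12)} (hB : B.card = 4) {V : Fin 12 → Fin 12 → SignType}
    (hV : ∀ b ∈ B, IsCell T (V b) ∧ V b b ≠ 0 ∧ ∀ b' ∈ B, b' ≠ b → V b b' = 0) :
    ∃ b ∈ B, IsPos M' (V b) ∨ IsPos M' fun e => -V b e := by
  by_contra hcon
  push Not at hcon
  refine hM'.2.1 fun X hX => ?_
  have hL : ∀ b, ∃ Y : Option (Fin 12) → SignType, b ∈ B → X (some b) ≠ 0 → Y ∈ M'.covectors ∧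
      Y (some b) = -X (some b) ∧ (∀ b' ∈ B, b' ≠ b → Y (some b') = 0) ∧ Y none = 0 := by
    intro b
    by_cases hb : b ∈ B
    swap
    · exact ⟨X, fun h => absurd h hb⟩
    obtain ⟨hc, hbb, hb0⟩ := hV b hb
    obtain ⟨Y, hY, hYV⟩ := hT.exists_lift hM' hc
    have hY0 : Y none = 0 := by
      rcases (Y none).trichotomy with h | h | h
      · exact absurd ⟨_, M'.neg_mem Y hY, by rw [h]; rfl, fun e => by rw [hYV e]⟩ (hcon b hb).2
      · exact h
      · exact absurd ⟨Y, hY, h, hYV⟩ (hcon b hb).1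
    by_cases h : Y (some b) = -X (some b)
    · exact ⟨Y, fun _ _ => ⟨hY, h, fun b' hb' hne => by rw [hYV, hb0 b' hb' hne], hY0⟩⟩
    · refine ⟨fun e => -Y e, fun _ hXb => ⟨M'.neg_mem Y hY, ?_, fun b' hb' hne => by
        simp [hYV, hb0 b' hb' hne], by simp [hY0]⟩⟩
      show -Y (some b) = _
      have h1 : Y (some b) ≠ 0 := by rwa [hYV]
      clear * - h h1 hXb
      generalize Y (some b) = y at *
      generalize X (some b) = x at *
      revert x y
      decide
  choose Y hY using hL
  obtain ⟨Z, hZ, hZB, hZ0⟩ := exists_eliminate (s := X none) hX (Or.inr rfl) (Y := Y)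
    fun b hb h => by
      obtain ⟨h1, h2, h3, h4⟩ := hY b hb h
      exact ⟨h1, h2, h3, Or.inl h4⟩
  exact (hZ0 (hT.none_eq_zero hM' hZ hB hZB)).1

/-- If the new element meets a simplicial cell then its vertices are not all strictly on one
side. -/
lemma not_same_side (hT : IsUniform T) (hM' : hT.toOrientedMatroid.IsOneElementExtension M')
    {U : Fin 12 → SignType} (hU : M'.NewElementMeets U)
    {B : Finset (Fin 12)} (hB : B.card = 4) {V : Fin 12 → Option (Fin 12) → SignType}
    (hV : ∀ b ∈ B, V b ∈ M'.covectors ∧ V b (some b) = U b ∧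
      ∀ b' ∈ B, b' ≠ b → V b (some b') = 0) {s : SignType} (hs : s ≠ 0) :
    ∃ b ∈ B, V b none ≠ s := by
  by_contra hcon
  push Not at hcon
  obtain ⟨X, hX, hX0, ⟨e, he⟩, hXU⟩ := hU
  -- Removing the entries of `X` on `B` uses negated corners, each with the entry `-s` at `none`.
  -- The end result vanishes at `none`, so none was used: `X` vanishes on `B`, hence at all old
  -- elements.
  obtain ⟨Z, hZ, hZB, hZ0⟩ := exists_eliminate (s := -s) (B := B) hX (Or.inl hX0)
    (Y := fun b e => -V b e) fun b hb h => by
      obtain ⟨h1, h2, h3⟩ := hV b hb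
      refine ⟨M'.neg_mem _ h1, ?_, fun b' hb' hne => by rw [h3 b' hb' hne]; rfl,
        Or.inr (by rw [hcon b hb])⟩
      have h4 : X (some b) = U b := (hXU b).resolve_left h
      rw [h2, h4]
  have h1 := (hZ0 (hT.none_eq_zero hM' hZ hB hZB)).2
  refine he (hT.eq_zero_of_four_zeros (hT.isCell_of_mem hM' hX) ?_ e)
  rw [← List.toFinset_card_of_nodup (nodup_zeros _), ← hB]
  refine Finset.card_le_card fun b hb => ?_
  rw [List.mem_toFinset, mem_zeros]
  by_contra hne
  have := h1 b hb hne
  rw [hcon b hb] at this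
  exact hs (by simpa using this)

end IsUniform

end TopeBitmap

/-! Resolution refutations of the existence of one-element extensions. The literal `2 * v + 1`
says that the vertex number `v` is positive, and the literal `2 * v` is its negation. Clauses are
bit masks of literals. -/

namespace TopeBitmap

open SignVec OrientedMatroid

/-- The set of elements with the bit mask `z`. -/
def zeroList (z : ℕ) : List (Fin 12) := (List.finRange 12).filter fun e => z.testBit e

/-- The positive elements of the vertex number `v`, one of the two with zero set `v / 2`. -/
def vertexMask (T v : ℕ) : ℕ := (bits 12 (cells T (zeroList (v / 2))) 0).getD (v % 2) 0

/-- The vertex number `v`. -/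
def vertexVec (T v : ℕ) : Fin 12 → SignType := decode (zeroList (v / 2)) (vertexMask T v)

/-- The literal `i` is true. -/
def Lit (T : ℕ) (M' : OrientedMatroid (Option (Fin 12))) (i : ℕ) : Prop :=
  IsPos M' (vertexVec T (i / 2)) ↔ i % 2 = 1

/-- The clause `c` is true. -/
def Holds (T : ℕ) (M' : OrientedMatroid (Option (Fin 12))) (c : ℕ) : Prop :=
  ∃ i, c.testBit i ∧ Lit T M' i

/-- The partner of `i` in the pair `2 * k`, `2 * k + 1`. -/
def partner (i : ℕ) : ℕ := if i % 2 = 0 then i + 1 else i - 1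

/-- Remove `l` from `c`. -/
def clear (c l : ℕ) : ℕ := c ^^^ (c &&& 2 ^ l)

/-- The resolvent on the literal `l` of `c` and its negation in `d`. -/
def resolve (c d l : ℕ) : ℕ := clear c l ||| clear d (partner l)

/-- The clause with the literals `ls`. -/
def clauseOf (ls : List ℕ) : ℕ := ls.foldr (fun l c => 2 ^ l ||| c) 0

/-- A clause that is always true. -/
def tautology : ℕ := clauseOf [0, 1]

/-- If `v₁` is positive, then `v₂` or the vertex `v₃` between `v₁` and `-v₂` is. -/
def lineClause (T c e v₁ v₂ v₃ : ℕ) : ℕ :=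
  if c < 12 ∧ e < 12 ∧ (zeroList (v₂ / 2)).length = 3 ∧ (zeroList (v₃ / 2)).length = 3 ∧
      v₃ / 2 = (v₁ / 2 &&& v₂ / 2) ||| 2 ^ e ∧ (v₁ / 2).testBit e = false ∧
      (v₂ / 2).testBit e = false ∧ (v₁ / 2).testBit c = true ∧ (v₂ / 2).testBit c = false ∧
      (v₃ / 2).testBit c = false ∧ (vertexMask T v₁).testBit e = (vertexMask T v₂).testBit e ∧
      (vertexMask T v₃).testBit c ≠ (vertexMask T v₂).testBit c
  then clauseOf [2 * v₁, 2 * v₂ + 1, 2 * v₃ + 1] else tautology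

/-- The opposite vertices `v` and `partner v`, which differ at `e`, are not both positive. -/
def oppositeClause (T e v : ℕ) : ℕ :=
  if e < 12 ∧ (zeroList (v / 2)).length = 3 ∧ (v / 2).testBit e = false ∧
      (vertexMask T v).testBit e ≠ (vertexMask T (partner v)).testBit e
  then clauseOf [2 * v, 2 * partner v] else tautology

/-- The clause and the pivot literal encoded by `n`. -/
def hint (T : ℕ) (db : List ℕ) (n : ℕ) : ℕ × ℕ :=
  if n % 3 = 0 then
    -- Zero sets are masks below `2 ^ 12`, so vertex numbers are below `2 ^ 13` and literals below
    -- `2 ^ 14`.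
    (db.getD (n / 3 / 2 ^ 14) tautology, n / 3 % 2 ^ 14)
  else if n % 3 = 1 then
    (eager (oppositeClause T (n / 6 % 12)) (n / 72), 2 * (if n / 3 % 2 = 0 then n / 72 else
      partner (n / 72)) + 1)
  else
    -- The mask `z` holds the two zeros common to the three vertices of the line. Each vertex has
    -- one further zero, and `s` says which of the two opposite vertices is meant.
    let z := 2 ^ (n / 9 % 12) ||| 2 ^ (n / (9 * 12) % 12)
    let c := n / (9 * 12 ^ 2) % 12
    let e := n / (9 * 12 ^ 4) % 12
    let s := n / (9 * 12 ^ 5)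
    let v₁ := 2 * (z ||| 2 ^ c) + s % 2
    let v₂ := 2 * (z ||| 2 ^ (n / (9 * 12 ^ 3) % 12)) + s / 2 % 2
    let v₃ := 2 * (z ||| 2 ^ e) + s / 4
    (eager (fun v₁ => eager (fun v₂ => eager (fun v₃ => lineClause T c e v₁ v₂ v₃) v₃) v₂) v₁,
      if n / 3 % 3 = 0 then 2 * v₁ + 1 else if n / 3 % 3 = 1 then 2 * v₂ else 2 * v₃)

/-- The clause derived from `c` by resolving with the given hints. -/
def derive (T : ℕ) (db : List ℕ) : ℕ → List ℕ → ℕ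
  | c, [] => c
  | c, n :: ns => eager (fun c => derive T db c ns) (resolve c (hint T db n).1 (hint T db n).2)

/-- The steps derive the empty clause from `db`. -/
def refutes (T : ℕ) : List ℕ → List (List ℕ) → Bool
  | [], [] => false
  | c :: _, [] => c == 0
  | db, [] :: ls => refutes T db ls
  | db, (n :: ns) :: ls =>
    eager (fun c => refutes T (c :: db) ls) (derive T db (hint T db n).1 ns)

/-- The vertices `v b` are those opposite to `b` of the simplicial cone of the cell `U` with the
facets `B`. -/
def HasCorners (T : ℕ) (U : Fin 12 → SignType) (B : Finset (Fin 12)) (v : Fin 12 → ℕ) : Prop :=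
  ∀ b ∈ B, (zeroList (v b / 2)).length = 3 ∧ vertexVec T (v b) b = U b ∧
    ∀ b' ∈ B, b' ≠ b → vertexVec T (v b) b' = 0

lemma mem_zeroList {z : ℕ} {e : Fin 12} : e ∈ zeroList z ↔ z.testBit e := by
  simp [zeroList]

lemma zeros_vertexVec (T v : ℕ) : zeros (vertexVec T v) = zeroList (v / 2) :=
  List.filter_congr fun e _ => by
    rw [Bool.eq_iff_iff, decide_eq_true_iff, vertexVec, decode_eq_zero_iff, mem_zeroList]

/-! ### Soundness of the clauses and of resolution -/

section Refutation

variable {T : ℕ} {M' : OrientedMatroid (Option (Fin 12))}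

lemma testBit_clauseOf {ls : List ℕ} {i : ℕ} : (clauseOf ls).testBit i ↔ i ∈ ls := by
  induction ls with
  | nil => simp [clauseOf]
  | cons l ls ih =>
    have : clauseOf (l :: ls) = 2 ^ l ||| clauseOf ls := rfl
    rw [this, Nat.testBit_or, Nat.testBit_two_pow, Bool.or_eq_true, ih, List.mem_cons,
      decide_eq_true_iff, eq_comm]

lemma holds_clauseOf {ls : List ℕ} : Holds T M' (clauseOf ls) ↔ ∃ i ∈ ls, Lit T M' i := by
  simp only [Holds, testBit_clauseOf]

lemma lit_two_mul {v : ℕ} : Lit T M' (2 * v) ↔ ¬ IsPos M' (vertexVec T v) := by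
  have h1 : 2 * v / 2 = v := by omega
  have h2 : ¬ 2 * v % 2 = 1 := by omega
  rw [Lit, h1, iff_false_right h2]

lemma lit_two_mul_add_one {v : ℕ} : Lit T M' (2 * v + 1) ↔ IsPos M' (vertexVec T v) := by
  have h1 : (2 * v + 1) / 2 = v := by omega
  have h2 : (2 * v + 1) % 2 = 1 := by omega
  rw [Lit, h1, iff_true_right h2]

lemma Lit.not_partner {i : ℕ} (h : Lit T M' i) : ¬ Lit T M' (partner i) := by
  unfold partner
  obtain ⟨k, rfl | rfl⟩ := Nat.even_or_odd' i
  · rw [lit_two_mul] at h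
    rwa [if_pos (by omega), lit_two_mul_add_one]
  · rw [lit_two_mul_add_one] at h
    rw [if_neg (by omega), Nat.add_sub_cancel, lit_two_mul]
    exact fun h' => h' h

lemma holds_tautology : Holds T M' tautology := by
  rw [tautology, holds_clauseOf]
  by_cases h : IsPos M' (vertexVec T 0)
  · exact ⟨1, by simp, (lit_two_mul_add_one (v := 0)).2 h⟩
  · exact ⟨0, by simp, (lit_two_mul (v := 0)).2 h⟩

lemma testBit_clear {c l i : ℕ} (h : c.testBit i) (hi : i ≠ l) : (clear c l).testBit i := by
  rw [clear, Nat.testBit_xor, Nat.testBit_and, Nat.testBit_two_pow]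
  simp [h, hi.symm]

/-- A literal and its partner are never both true. Nothing requires `l` to occur in the clauses, so
the hints need not be trusted. -/
lemma holds_resolve {c d : ℕ} (hc : Holds T M' c) (hd : Holds T M' d) (l : ℕ) :
    Holds T M' (resolve c d l) := by
  obtain ⟨i, hi, hL⟩ := hc
  obtain ⟨j, hj, hL'⟩ := hd
  by_cases h : i = l
  · subst h
    refine ⟨j, ?_, hL'⟩
    rw [resolve, Nat.testBit_or, testBit_clear hj (by rintro rfl; exact hL.not_partner hL'),
      Bool.or_true]
  · exact ⟨i, by rw [resolve, Nat.testBit_or, testBit_clear hi h, Bool.true_or], hL⟩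

namespace IsUniform

lemma isCell_vertexVec (hT : IsUniform T) {v : ℕ} (h : (zeroList (v / 2)).length = 3) :
    IsCell T (vertexVec T v) :=
  hT.isCell_decode_getD List.filter_sublist h (Nat.mod_lt _ (by norm_num))

/-- Both vertices have the same three zeros, so they are equal or opposite, and they differ at `e`.
-/
lemma vertexVec_partner (hT : IsUniform T) {v : ℕ} (h : (zeroList (v / 2)).length = 3)
    {e : Fin 12} (he : (v / 2).testBit e = false)
    (hne : (vertexMask T v).testBit e ≠ (vertexMask T (partner v)).testBit e) :
    vertexVec T (partner v) = fun e => -vertexVec T v e := by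
  have h2 : partner v / 2 = v / 2 := by
    unfold partner
    split_ifs <;> omega
  have hz : ∀ f, vertexVec T v f = 0 ↔ vertexVec T (partner v) f = 0 := fun f => by
    rw [← mem_zeros, ← mem_zeros, zeros_vertexVec, zeros_vertexVec, h2]
  refine (hT.eq_or_eq_neg (hT.isCell_vertexVec h) (hT.isCell_vertexVec (by rwa [h2])) hz
    (by rwa [zeros_vertexVec])).resolve_left fun heq => hne ?_
  have he' : e ∉ zeroList (v / 2) := by rw [mem_zeroList, he]; simp
  rw [← decode_eq_iff (l := zeroList (v / 2)) (l' := zeroList (partner v / 2)) he'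
    (by rwa [h2])]
  exact (congrFun heq e).symm

lemma holds_oppositeClause (hT : IsUniform T)
    (hM' : hT.toOrientedMatroid.IsOneElementExtension M') (e v : ℕ) :
    Holds T M' (oppositeClause T e v) := by
  unfold oppositeClause
  split_ifs with h
  · obtain ⟨he, hlen, hz, hne⟩ := h
    rw [holds_clauseOf]
    by_cases hp : IsPos M' (vertexVec T v)
    · refine ⟨2 * partner v, by simp, ?_⟩
      rw [lit_two_mul, hT.vertexVec_partner hlen (e := ⟨e, he⟩) hz hne]
      exact hT.not_isPos_neg hM' (by rwa [zeros_vertexVec]) hp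
    · exact ⟨2 * v, by simp, lit_two_mul.2 hp⟩
  · exact holds_tautology

lemma holds_lineClause (hT : IsUniform T)
    (hM' : hT.toOrientedMatroid.IsOneElementExtension M') (c e v₁ v₂ v₃ : ℕ) :
    Holds T M' (lineClause T c e v₁ v₂ v₃) := by
  unfold lineClause
  split_ifs with h
  · obtain ⟨hc, he, hlen₂, hlen₃, hz, h1e, h2e, h1c, h2c, h3c, hse, hsc⟩ := h
    have hmem : ∀ {v : ℕ} {f : Fin 12}, (v / 2).testBit f = false → f ∉ zeroList (v / 2) := by
      intro v f hf
      rw [mem_zeroList, hf]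
      simp
    rw [holds_clauseOf]
    by_cases hp : IsPos M' (vertexVec T v₁)
    · have h0 : ∀ f, vertexVec T v₃ f = 0 →
          f = ⟨e, he⟩ ∨ vertexVec T v₁ f = 0 ∧ vertexVec T v₂ f = 0 := by
        intro f hf
        have h4 := decode_eq_zero_iff.1 hf
        rw [mem_zeroList, hz, Nat.testBit_or, Nat.testBit_and, Nat.testBit_two_pow] at h4
        simp only [Bool.or_eq_true, Bool.and_eq_true, decide_eq_true_eq] at h4
        rcases h4 with h4 | h4
        · exact Or.inr ⟨decode_eq_zero_iff.2 (mem_zeroList.2 h4.1),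
            decode_eq_zero_iff.2 (mem_zeroList.2 h4.2)⟩
        · exact Or.inl (Fin.ext h4.symm)
      rcases hT.isPos_of_line hM' (W₁ := vertexVec T v₁) (W₂ := vertexVec T v₂)
        (W₃ := vertexVec T v₃) (hT.isCell_vertexVec hlen₂) (hT.isCell_vertexVec hlen₃)
        (by rwa [zeros_vertexVec]) (c := ⟨c, hc⟩) (e := ⟨e, he⟩) h0
        (fun h => hmem (f := ⟨e, he⟩) h1e (decode_eq_zero_iff.1 h))
        ((decode_eq_iff (hmem (f := ⟨e, he⟩) h2e) (hmem (f := ⟨e, he⟩) h1e)).2 hse.symm)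
        (decode_eq_zero_iff.2 (mem_zeroList.2 h1c))
        (fun h => hmem (f := ⟨c, hc⟩) h3c (decode_eq_zero_iff.1 h))
        ((decode_eq_neg_iff (hmem (f := ⟨c, hc⟩) h3c) (hmem (f := ⟨c, hc⟩) h2c)).2 hsc) hp
        with h | h
      · exact ⟨2 * v₂ + 1, by simp, lit_two_mul_add_one.2 h⟩
      · exact ⟨2 * v₃ + 1, by simp, lit_two_mul_add_one.2 h⟩
    · exact ⟨2 * v₁, by simp, lit_two_mul.2 hp⟩
  · exact holds_tautology

lemma holds_hint (hT : IsUniform T)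
    (hM' : hT.toOrientedMatroid.IsOneElementExtension M') {db : List ℕ}
    (hdb : ∀ c ∈ db, Holds T M' c) (n : ℕ) : Holds T M' (hint T db n).1 := by
  unfold hint
  by_cases h1 : n % 3 = 0
  · rw [if_pos h1, List.getD_eq_getElem?_getD]
    cases h : db[n / 3 / 2 ^ 14]? with
    | none => exact holds_tautology
    | some c => exact hdb c (List.mem_of_getElem? h)
  rw [if_neg h1]
  by_cases h2 : n % 3 = 1
  · rw [if_pos h2, eager_eq]
    exact hT.holds_oppositeClause hM' _ _
  · rw [if_neg h2]
    simp only [eager_eq]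
    exact hT.holds_lineClause hM' _ _ _ _ _

lemma holds_derive (hT : IsUniform T)
    (hM' : hT.toOrientedMatroid.IsOneElementExtension M') {db : List ℕ}
    (hdb : ∀ c ∈ db, Holds T M' c) (ns : List ℕ) :
    ∀ c, Holds T M' c → Holds T M' (derive T db c ns) := by
  induction ns with
  | nil => exact fun c hc => hc
  | cons n ns ih =>
    intro c hc
    rw [derive, eager_eq]
    exact ih _ (holds_resolve hc (hT.holds_hint hM' hdb n) _)

/-- Every derived clause is true in the given extension, whereas the mask `0` has no literal to
satisfy. -/
lemma refutes_eq_false (hT : IsUniform T)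
    (hM' : hT.toOrientedMatroid.IsOneElementExtension M') (ls : List (List ℕ)) :
    ∀ db : List ℕ, (∀ c ∈ db, Holds T M' c) → refutes T db ls = false := by
  induction ls with
  | nil =>
    intro db hdb
    cases db with
    | nil => rfl
    | cons c db =>
      rw [refutes, beq_eq_false_iff_ne]
      rintro rfl
      obtain ⟨i, hi, -⟩ := hdb 0 (by simp)
      simp at hi
  | cons l ls ih =>
    intro db hdb
    cases l with
    | nil =>
      rw [refutes]
      exact ih db hdb
    | cons n ns =>
      rw [refutes, eager_eq]
      refine ih _ fun c hc => ?_
      rcases List.mem_cons.1 hc with rfl | hc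
      · exact hT.holds_derive hM' hdb ns _ (hT.holds_hint hM' hdb n)
      · exact hdb c hc

/-- If all these literals failed, every corner would have a lift that is positive at `none`, against
`not_same_side`. -/
lemma holds_corner (hT : IsUniform T) (hM' : hT.toOrientedMatroid.IsOneElementExtension M')
    {U : Fin 12 → SignType} (hU : M'.NewElementMeets U) {B : Finset (Fin 12)} (hB : B.card = 4)
    {v : Fin 12 → ℕ} (hv : HasCorners T U B v) {ls : List ℕ} (hls : ∀ b ∈ B, 2 * v b ∈ ls) :
    Holds T M' (clauseOf ls) := by
  rw [holds_clauseOf]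
  by_contra hcon
  push Not at hcon
  have h : ∀ b, ∃ X : Option (Fin 12) → SignType, b ∈ B →
      X ∈ M'.covectors ∧ X none = 1 ∧ ∀ e, X (some e) = vertexVec T (v b) e := by
    intro b
    by_cases hb : b ∈ B
    · have := hcon _ (hls b hb)
      rw [lit_two_mul, not_not] at this
      obtain ⟨X, h1, h2, h3⟩ := this
      exact ⟨X, fun _ => ⟨h1, h2, h3⟩⟩
    · exact ⟨fun _ => 0, fun h => absurd h hb⟩
  choose X hX using h
  obtain ⟨b, hb, hne⟩ := hT.not_same_side hM' hU hB (V := X) (fun b hb =>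
    ⟨(hX b hb).1, by rw [(hX b hb).2.2, (hv b hb).2.1], fun b' hb' hne => by
      rw [(hX b hb).2.2, (hv b hb).2.2 b' hb' hne]⟩) (s := 1) (by decide)
  exact hne (hX b hb).2.1

/-- This clause rules out the assignment without positive vertices. The corner numbered `v' b` is
the negative of the one numbered `v b`, so both signs in `exists_isPos` are covered. -/
lemma holds_corner_pos (hT : IsUniform T)
    (hM' : hT.toOrientedMatroid.IsOneElementExtension M') {U : Fin 12 → SignType}
    (hU : ∀ e, U e ≠ 0) {B : Finset (Fin 12)} (hB : B.card = 4) {v v' : Fin 12 → ℕ}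
    (hv : HasCorners T U B v) (hv' : HasCorners T (fun e => -U e) B v') {ls : List ℕ}
    (hvv' : ∀ b ∈ B, v' b / 2 = v b / 2) (hls : ∀ b ∈ B, 2 * v b + 1 ∈ ls ∧ 2 * v' b + 1 ∈ ls) :
    Holds T M' (clauseOf ls) := by
  rw [holds_clauseOf]
  obtain ⟨b, hb, h⟩ := hT.exists_isPos hM' hB (V := fun b => vertexVec T (v b)) fun b hb =>
    ⟨hT.isCell_vertexVec (hv b hb).1, by rw [(hv b hb).2.1]; exact hU b, (hv b hb).2.2⟩
  rcases h with h | h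
  · exact ⟨_, (hls b hb).1, lit_two_mul_add_one.2 h⟩
  · refine ⟨_, (hls b hb).2, lit_two_mul_add_one.2 ?_⟩
    have h1 : (fun e => -vertexVec T (v b) e) = vertexVec T (v' b) :=
      hT.eq_of_zeros_subset (hT.isCell_vertexVec (hv' b hb).1)
        (hT.neg (hT.isCell_vertexVec (hv b hb).1)) (by rw [zeros_vertexVec, (hv' b hb).1])
        (fun e he => by
          rw [← mem_zeros, zeros_vertexVec, hvv' b hb, ← zeros_vertexVec T, mem_zeros] at he
          simp [he])
        (c := b) (by rw [(hv' b hb).2.1]; simpa using hU b)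
        (by rw [(hv' b hb).2.1, (hv b hb).2.1])
    rwa [← h1]

end IsUniform

end Refutation

end TopeBitmap

/-! ### The explicit example and its refutation -/

namespace TopeBitmap

open SignVec OrientedMatroid

/-- The topes of an oriented matroid of rank 4 on 12 elements. -/
def topes : ℕ := List.foldr (fun w T => T * 2 ^ 320 + w) 0 [
  -- The entries are words of 320 bits, the least significant word first.
  0x8a0a00000a0a000ac000c0c0000000ca0000000000000000c0000000000000008000000000000000,
  0x8808c8cc080888ce000000000000000e8808000008080008,
  0xf0000000000000000020a0000020a000a00000000000000df0000000000000000,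
  0xd000d0c0fa00faca0000000000000000f2000000fa003200a20000000000000000000000000000cf,
  0x3200100033131113880088808a0a8a8a000000000000000aaa000000aa0a020aaa0000000a0a000a,
  0x2000000020202020200000002030003100010001000ffdf10001000100010133200000033033313,
  0x4040404000000040c000000000000000c04000000000000000000000000002030000000000000003,
  0xc888c8cc0008004cc8ccc0cc0000004cc808000800080008fbff000800080008c000c04000000040,
  0x535f005f030b000b5000505000000055504050550000005550000000000000005151505101110011,
  0xf000000000000000f3000000000000000000000000000045004c005f0000004f0000000000000000,
  0xfb0000000000000050005040000050400000000000000000,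
  0x50005050000050511000101000001011700000000000000073111010331310110000000000000000,
  0x1000000000000000300000000000000005300000003030003]

/-- A simplicial tope with the facets `0, 1, 2, 3`. -/
def leftTope : Fin 12 → SignType := decode [] 2357

/-- A simplicial tope with the facets `4, 5, 6, 7`. -/
def rightTope : Fin 12 → SignType := decode [] 2403

/-- The vertex of `leftTope` opposite to the facet `b`. -/
def leftCorner (b : Fin 12) : ℕ := [29, 27, 23, 15].getD b 0

/-- The vertex of `rightTope` opposite to the facet `b`. -/
def rightCorner (b : Fin 12) : ℕ := [449, 417, 353, 225].getD (b - 4) 0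

/-- A resolution refutation of the existence of an extension that meets both topes. -/
def refutation : List (List ℕ) :=
  [[7775390, 148803, 2139197, 8823980, 11850143, 11833295, 322561], [49152, 11241845, 8794877,
  8772971, 2017, 8781071, 8796299, 8807135, 8810996, 2406, 11897081, 12677318, 184609, 8877398,
  8908502, 442657, 304705, 8626127, 12057938, 322561, 8641679], [98304, 11241845, 8794877,
  13237685, 8772971, 2017, 8781071, 8796299, 8807135, 8810996], [147456, 17738690, 8794877,
  8772971, 296356, 8781071, 8790260, 8796299, 24696, 8807135, 8810996], [196608, 8044493, 8043305,
  622856, 8772971, 840593, 20161, 8796299, 1279946, 11679047, 168193, 922268, 1294202, 8008781,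
  346563, 7775396, 2123654, 8823980, 11850143, 2409, 12057938, 304705, 322561, 8641679, 8626127,
  641414, 1463123, 12454523, 1463105, 1465697, 1936181, 1940069, 907157, 11833739, 315649,
  8659832, 460801], [245760, 17764385, 17738690, 8772971, 8790260, 8796299], [294912, 17764385,
  17738690, 17781890, 8799341, 16595027, 17158724, 7246265, 358040, 8772971, 2017], [344064,
  17764385, 11241845, 13237685, 8772971, 2017], [491520, 17815613, 17816801, 16785314, 16598690],
  [17882903, 16505699, 8179751, 17882894, 10707068, 8179742], [638976, 8179757, 7619885],
  [17789708, 12677318, 469257, 8877398, 442657], [147456, 8655941, 315652, 4960580, 907163],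
  [296353, 270456, 368766, 8796299, 1465697], [12668330, 315652, 74694, 907163, 26208, 20161],
  [835584, 17816801, 16771058, 17819501, 17835053], [786432, 8043305, 8044493, 840593, 622856,
  922268, 1294202, 936387, 7775396, 2123654, 8823980, 11850143, 592233, 21889, 8772971, 641414,
  7156004, 8796299, 1463123, 8790260, 1463105, 1465697, 1936181, 907157, 315649, 304705, 322561,
  8655944, 8626127, 8659823, 8706479, 12473981, 13035068, 73770, 20161, 451585, 8503043, 1638128,
  1634240, 1639424, 1640720, 479233, 460801, 8518595], [7775390, 984387, 2139197, 8823980,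
  11850143, 922274, 8810993, 11679044, 907157, 11833739, 315649, 322561, 8655944, 8659823,
  8706479, 460801], [7775390, 1033539, 2123654, 8823980, 922274, 12057938, 11850143, 322561,
  8641679], [296353, 565368, 614526], [4721546, 1032279, 11880653, 2071337, 358046, 1882],
  [11023364, 13036430, 5023052, 405508], [540672, 2139197], [16505696, 17882894, 17882903,
  12183644, 25737, 641472, 17224859, 17349266, 13242278, 13240982, 1890785, 82947, 8798411,
  559137, 296353, 17547749, 12490667, 17769797, 17583173, 17781890, 8799341, 16595027, 17158724,
  2110106, 7246265, 12665783, 641414, 1463123, 1463105, 17718635, 12682523, 17836589, 17788412,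
  223497, 11679044, 11833739, 1936181, 8810993, 12667079, 147633, 1465697, 907157, 13035062,
  1634240, 12473975, 277257, 296601, 13035125, 917001, 1640720, 1638128, 479233, 451585, 8503043,
  460801, 8518595], [8518556, 1502039, 8690945, 405505, 6857114, 4789694, 16595021, 401097,
  12668330, 8299514, 8591123, 11053694, 8250230, 1228887, 172101, 2071337, 358046, 156, 17789708,
  272649, 1043246, 9001943, 1986707, 8810993, 1463105, 1465697, 11679044, 1936181, 1940069,
  907157, 1986698, 11833739, 1639424, 460801, 7401437, 966153, 1640720, 1638128, 13035062,
  12473975, 326409, 345753, 451585, 8503043, 8518595, 1634240, 479233, 516097], [8518556, 8690945,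
  1502039, 6857114, 479233, 8655941, 315652, 26304, 460801, 8518595, 516097], [5197070, 17773454,
  1327239, 1030], [405505, 82944, 6857114], [49152, 4774814], [9001937, 4602440, 7246262, 159,
  11053697, 4789700, 79884, 17158718, 16595021, 646857, 17789708, 985449, 8655941, 12668330,
  315652, 222912, 13035062, 12473975, 572169, 591513, 7401437, 1211913, 460801, 1640720, 1639424,
  1634240, 1638128, 451585, 8518595, 479233, 8503043, 516097], [1572864, 17630177, 17628989,
  17191280, 16926905, 17349347, 17753762, 17755058, 12832976, 39945, 516097, 16771058], [8468021,
  11305802, 12645017, 15900086, 1892135, 1889543, 8624990, 9501959, 6144131, 11147987, 12832976,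
  89097, 516097], [17195168, 17349347, 17753762, 12832976, 138249, 516097], [8790257, 7156001,
  4960577, 16956362, 16583132, 100809, 16926905, 14601, 17755058, 187401, 20161], [2139194,
  315649, 1820739, 11492438, 8468024, 7993016, 12085145, 12645017, 6942395, 8407703, 1892135,
  1889543, 100800, 8607728, 6383783, 9501959, 2072171, 11147987, 8622398, 6144131, 12832976,
  236553, 516097], [5945960, 4727288, 9205403, 4534931, 6779603, 1769559, 10267250, 17583167,
  17139944, 4774814, 17345468, 50841, 17345459, 17748578, 7229078, 12834272, 12832976, 285705,
  516097], [2017, 11255990, 8643254, 55374, 12149900, 9501086, 17758016, 8609546, 11914346,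
  11713040, 1698842, 358859, 6146723, 6144131, 11147987, 184609, 17740742, 15390, 1882, 12832976,
  334857, 516097], [1818624, 11914352, 11915540], [147456, 12149900, 11255987, 9501086, 17758016,
  11440010, 93, 2017, 49311, 1698842, 6144131, 11713040, 358859, 11147987, 12832976, 516097,
  9097721, 7042454, 433161], [12149894, 221589, 9501086, 17758016, 11440010, 8643251, 11913059,
  177, 11713040, 358859, 6146723, 6144131, 11147987, 9097721, 7042454, 12832976, 482313, 516097,
  98463], [17139944, 4507835, 17345468, 11068943, 296601, 17748578, 5025752, 184612, 15384,
  147615, 12834272, 531465, 516097], [17815610, 2115657, 4587341, 315652, 4773749, 5933024,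
  4773974, 5366681, 5926553, 5431436, 17191415, 10644815, 10644491, 17565959, 2081600, 17585399,
  227234, 13104839, 13100951, 7262471, 10845146, 9188429, 7075856, 10864478, 10860590, 7261598,
  10836083, 5194595, 11013278, 17748587, 12862595, 12865187, 1862153, 8908499, 184612, 43017],
  [2162688, 17630177, 17628989, 16771058, 16583138, 16955063, 17139950, 17753753, 17753726,
  17749865, 17751161, 17748533, 17350643, 17346755, 17345459, 17381936, 17376752, 17378048,
  92169], [16004108, 17748587, 61506, 12865187, 8908499, 442657, 36894, 2017, 184612, 141321],
  [4773746, 5366681, 10644491, 17565959, 5431436, 13100951, 7262471, 2081600, 10860590, 7261598,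
  10836083, 190473], [5195882, 2261151, 5197076], [2359296, 17815613], [4587338, 2505, 4773974,
  315652, 5933024, 17191415, 5366681, 5926553, 17585399, 10644815, 17565959, 5431436, 227234,
  7075856, 13104839, 7262471, 99654, 2081600, 10864478, 10860590, 7261598, 10836083, 10845146,
  49239, 245928, 9188429, 16004108, 11013278, 17748587, 12862595, 12865187, 1862153, 8908499,
  184612, 337929], [2457600, 16771058, 17628989, 17751161, 17753753, 17350643, 184612, 17381936,
  442660, 36888, 387081], [2457600, 4721552, 10282793, 4774814, 10832747, 16952465, 16955057,
  4928210, 16583132, 5772239, 11131142, 17748569, 17749865, 17753753, 17350643, 17381936,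
  16018904, 17748533, 17376752, 17345459, 184612, 4507838, 11068943, 5025752, 17383232, 17375456,
  442660, 86040, 245937, 436233], [49152, 17630177, 2502, 17753726, 17346755, 17378048, 442660,
  135192, 184612, 485385], [442657, 1674230, 17381939, 12339068, 16973564, 534537, 15387], [0,
  8008781, 272070, 16771058, 29953], [17521868, 17551703, 16802603, 11694782, 17584022, 11878058,
  11880650, 17380640, 16004288, 632841], [8044490, 2654301, 8043305, 11477726, 162, 858629,
  1466462, 158977, 17832785, 17378048, 840593, 1279946, 168193, 681993], [8044490, 2703453,
  8043305, 11477726], [16802597, 17584022, 17521868, 16361984, 17225120, 6967154, 17551703,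
  6947669, 6951557, 11694782, 11304056, 11878058, 11880650, 165, 858629, 1466462, 1330814,
  1670339, 1669043, 442657, 86046, 840593, 1279946, 168193, 261147, 780297], [858629, 1466462,
  11304059, 1330814, 6947672, 1670339, 1669043, 6967157, 442657, 17225126, 17380643, 17521871,
  17551703, 11694782, 11878058, 310299, 829449], [1670339, 442657, 1330817, 6146726, 1466465,
  11913062, 858635, 2850993, 99216, 8044493, 8043305, 162, 17127920, 460804, 8655947, 16785311,
  543369, 75465, 840584, 852230, 840593, 1278650, 1276058, 1279946, 168193, 11833298, 906716,
  905420, 902828, 175105, 260358, 29953, 359451, 878601], [2899968, 17187881, 16018910, 17724422,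
  16597685, 16595093, 16579649, 17158862, 17143418], [1670339, 442657, 7029332, 17378051, 457755,
  976905], [11897075, 17379347, 7213871, 16579670, 7156001, 7171961, 21892, 17764388, 5197760,
  10849160, 17187881, 5162186, 840590, 10825832, 11440010, 8044496, 49245, 1879, 17146010,
  16597685, 17724422, 16579649, 17143418, 16595093, 17158862, 37065, 506907, 1026057], [3096576,
  10267250, 10825835, 1906754, 19876, 1141268, 5197760, 840590, 4721552], [3145728, 9739553,
  10267250, 10825835, 12659771, 1906754, 19876, 16393898, 1141268, 21892, 5195168, 852236,
  11694785, 11878058, 1599, 1670339, 1669043, 605211], [3194880, 6778313, 10267250, 10825835,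
  2020, 460421, 9799625, 10408871, 10397531, 8981030, 11676530, 11035010, 37309, 19876, 11368097,
  1141268, 17333909, 5195168, 15907058, 8778845, 852236, 17613848, 8812478, 11694785, 17595704,
  74458, 37594, 296644, 9672269, 9656717, 5195582, 17551706, 17375456, 654363, 1173513],
  [17773454, 7171958, 11929898, 24639, 16512230, 17771846, 2048663, 16579667, 17350649, 11147987,
  17379344, 9097721, 442660, 86040, 147621, 16597685, 8184818, 17158862, 17161454, 17139530,
  17146010, 233673, 5756807, 10927847, 5755511, 17551706, 10945964, 17521874, 17225120, 7029362,
  6978809, 17753756, 5772233, 17127920, 460804, 8655947, 322561, 16785311, 3295881, 5761514,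
  8008778, 17628989, 308937, 902828, 905420, 906716, 11833298, 175105, 604422, 29953, 703515,
  1222665], [17773454, 7171958, 11929898], [3342336, 6778313, 10282793, 17139944, 4774814,
  4602446, 16952465, 16955057, 16598684, 17521868, 129801, 17380640, 5195582, 17375456, 1320969],
  [3391488, 4534937, 10282793, 4727294, 4774814, 4602446, 16952465, 16955057, 16583132, 17753753,
  1228977, 17350643, 17771843, 12369, 5945966, 5195582, 73788, 2048663, 11964521, 5756807,
  10927847, 5755511, 16512230, 5772233, 10945964, 16579667, 11147987, 17375456, 17381936,
  17380640, 17379344, 9097721, 442660, 17146010, 17139530, 381129, 9875036, 8654204, 1370121,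
  850971], [9739550, 3440727, 10267250, 10825835], [5195882, 17758010, 3637332, 11915534, 6144131,
  16221071, 11897075, 7215167, 529103, 7213871, 4774808, 171, 17139944, 16955057, 16598684,
  17521868, 12088559, 17225120, 9862301, 11880650, 6967154, 17551703, 12659771, 4740617, 11964521,
  345663, 6947669, 325653, 1670339, 1674227, 1669043, 86043, 902828, 782300, 4928204, 17648426,
  16953770, 16597685, 17158862, 8184818, 5761514, 17161454, 479433, 949275, 1468425], [17529554,
  17345465, 17383232, 442660, 1674230, 17849675, 11964524, 7353353, 17583173, 10843127, 4741553,
  10267253, 4519487, 1517577, 998427], [442657, 6146726, 1670342, 6520409, 12659774, 6779603,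
  9739556, 3588183, 132, 10825835, 17139944, 10849163, 20164, 1047579], [6146723, 6520409, 442660,
  6779603, 1670342, 3637335, 12659774, 10267250, 147690, 10825835, 2020, 1096731], [1435916,
  10046216, 9427028, 6354038, 2093381, 11676530, 4741559, 37594, 7353359, 9656717, 17849678,
  368700, 17529560, 17740742, 11039186, 17383232, 1665033, 1145883], [10927154, 3835203, 2139197,
  9384293, 11850143, 4960577, 16583132, 17753753, 17350643, 15393, 11035010, 37309, 11368097,
  17333909, 15907058, 17521874, 11063474, 199104, 16512230, 16579667, 17139530, 17146010,
  17161454, 9875036, 17380640, 11066024, 17599592, 17613848, 17595704, 7075208, 17375456,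
  16356215, 17566553, 17158871, 17799113, 17381936, 17379344, 11897075, 7213871, 12541727, 49323,
  7156001, 8654204, 5114828, 4922993, 99987, 16597685, 17158862, 725193, 16953770, 16956362,
  1195035, 1714185], [11850140, 12026396, 3885699, 10927157, 11063474, 2139197, 8008784, 315649,
  26310, 4922993, 149139, 16597685, 16956362, 16953770, 17161454, 17158862, 774345], [1674227,
  6982703, 442657, 17127926, 17376755, 36966, 1812489, 1293339], [858629, 1466462, 906716,
  3983811, 7774100, 11304059, 1330814, 7008593, 6951560, 1670339, 1669043, 442657, 17376755,
  168193, 7758656, 175105, 12035471, 1292550, 14022, 1342491, 1861641], [1032192, 16598687,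
  840584, 852230, 906716, 11833298, 1278650, 1276058, 902828, 905420, 168193, 175105, 1341702,
  63174, 36969], [442657, 1670342, 17378051, 7008596, 17832788, 1959945, 1440795], [0, 7774094,
  4130115, 51648, 12035471, 1440006, 7758656, 161478], [1277952, 858629, 840584, 840593, 1466462,
  906716, 1278650, 1279946, 905420, 4180419, 7774100, 158977, 12035471, 175105, 62406, 1489158,
  7758656, 168193, 162], [460801, 17127926, 8655947, 1069158, 16598687, 905420, 11833298, 175105,
  49314, 8008778, 14025, 2107401], [1674227, 6982703, 442657, 17127926, 17376755, 1637403,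
  2156553], [4325376, 10927157, 2139197, 315649, 1156806, 11066024, 51648, 17599592, 12026399,
  16583135, 17375456, 4960580, 11897075, 8790263, 7213871, 7075208, 7156001, 17139950, 10825832,
  591507, 16018910, 16597685, 36969, 17158862, 17161454, 16953770, 16956362, 1216713, 112329,
  1879, 147618, 2205705, 1686555], [29953, 2502], [1032192, 51654], [17816798, 100806, 1353],
  [17630174, 149958, 50505], [158977, 13254], [1466462, 199107, 13251], [1987454, 248259, 62403],
  [7213871, 11897081, 7156001, 17375459, 21892, 17599598, 5197760, 11066030, 622859, 10849160,
  7075208, 8044496, 10825832, 1622109, 1526064, 1879, 8008778, 16597685, 430185, 17158862,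
  1609929, 2079771, 2598921, 297411], [7213871, 1179819, 7156001, 12659771, 1033875, 16393898,
  16597685, 479337, 17158862, 1659081, 11897081, 1670339, 442657, 2128923], [4519487, 4718727,
  10825835, 17139944, 10843124, 10849163, 20164, 622862, 4721552, 16597685, 528489, 17158862,
  1708233, 49317, 11964521, 1674227, 442657, 5197754, 21889, 1830, 2178075], [11878058, 1599,
  11648132, 1229618, 10883306, 21889, 50982, 17551706, 17517986, 17225120, 6967154, 6947669,
  1669043, 442657, 16597685, 577641, 17158862, 1757385, 98469, 154563, 2746377, 369606, 2227227],
  [10397531, 8981030, 9849002, 11676530, 9799628, 11035010, 460418, 37309, 1130667, 11368097,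
  19876, 17333909, 4741559, 16393898, 15907058, 17547338, 17613848, 8357366, 8778845, 17595704,
  8812478, 2048663, 296644, 74458, 37594, 7353359, 5756807, 10927847, 5755511, 5195582, 9672269,
  9656717, 6526226, 17849678, 377857, 1499196, 16512230, 17529560, 17740742, 17517986, 4837826,
  16579667, 17346761, 11147987, 17375456, 17380640, 17383232, 17379344, 36897, 147621, 8184818,
  17139530, 17146010, 16597685, 17753729, 17158862, 17161454, 5761514, 8008778, 626793, 1806537,
  443721, 2276379, 2795529, 418758, 357318, 494019], [168193, 14022], [2310144, 63174], [1279946,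
  641475, 63171], [1276058, 690627, 112323], [1278650, 739779, 161475], [175105, 162054], [906716,
  838083, 14595], [905420, 887235, 63747], [902828, 936387, 112899], [858629, 738339, 100707],
  [840593, 345891, 149859], [840584, 296691, 149811], [852230, 394959, 149775], [2703360, 148371,
  99951, 50751], [11304056, 197523, 165], [11878058, 149055, 49317], [11694782, 155151, 6213],
  [17551703, 3680265, 30741], [17517980, 1352646, 31497], [17380640, 3778569, 37638], [442657,
  36894], [1669043, 3357723, 36891], [6951557, 356505, 12411], [6947669, 405657, 61563],
  [17225120, 283398, 86121], [6967154, 3554331, 39942, 64617]]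

/-- The clauses saying that the new element meets both topes. -/
def cornerClauses : List (List ℕ) :=
  [[0, 1, 2, 3].map fun b => 2 * leftCorner b,
    [0, 1, 2, 3].map fun b => 2 * partner (leftCorner b),
    [4, 5, 6, 7].map fun b => 2 * rightCorner b,
    [4, 5, 6, 7].map fun b => 2 * partner (rightCorner b),
    [0, 1, 2, 3].flatMap fun b => [2 * leftCorner b + 1, 2 * partner (leftCorner b) + 1]]

/-- The clauses with the literals `ls`. -/
def clausesOf : List (List ℕ) → List ℕ
  | [] => []
  | l :: ls => eager (fun c => c :: clausesOf ls) (clauseOf l)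

lemma clausesOf_eq_map (ls : List (List ℕ)) : clausesOf ls = ls.map clauseOf := by
  induction ls with
  | nil => rfl
  | cons l ls ih => rw [clausesOf, eager_eq, ih, List.map_cons]

lemma refutes_refutation :
    eager (fun T => refutes T (clausesOf cornerClauses) refutation) topes = true := by
  decide +kernel

lemma isUniform_topes : IsUniform topes where
  lt := by decide +kernel
  symm := by decide +kernel
  rigid := by decide +kernel
  vertex := by decide +kernel
  generic := by decide +kernel

lemma hasCorners_left : HasCorners topes leftTope {0, 1, 2, 3} leftCorner := by
  unfold HasCorners
  decide +kernel

lemma hasCorners_left_neg : HasCorners topes (fun e => -leftTope e) {0, 1, 2, 3}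
    fun b => partner (leftCorner b) := by
  unfold HasCorners
  decide +kernel

lemma hasCorners_right : HasCorners topes rightTope {4, 5, 6, 7} rightCorner := by
  unfold HasCorners
  decide +kernel

lemma hasCorners_right_neg : HasCorners topes (fun e => -rightTope e) {4, 5, 6, 7}
    fun b => partner (rightCorner b) := by
  unfold HasCorners
  decide +kernel

lemma partner_div_two (v : ℕ) : partner v / 2 = v / 2 := by
  unfold partner
  split_ifs <;> omega

lemma decode_nil_ne_zero (m : ℕ) (e : Fin 12) : decode [] m e ≠ 0 := fun h =>
  List.not_mem_nil (decode_eq_zero_iff.1 h)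

lemma IsUniform.isTope_decode {T m : ℕ} (hT : IsUniform T) (hm : m < 4096) (h : T.testBit m) :
    hT.toOrientedMatroid.IsTope (decode [] m) :=
  ⟨isCell_decode hm List.nodup_nil h, fun _ _ hY => funext fun e =>
    ((hY e).resolve_left (decode_nil_ne_zero m e)).symm⟩

lemma _root_.OrientedMatroid.NewElementMeets.neg {E : Type*} {M' : OrientedMatroid (Option E)}
    {U : E → SignType} (h : M'.NewElementMeets U) : M'.NewElementMeets fun e => -U e := by
  obtain ⟨X, hX, h0, ⟨e, he⟩, hXU⟩ := h
  refine ⟨_, M'.neg_mem X hX, by simp [h0], ⟨e, by simpa using he⟩, fun f => ?_⟩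
  rcases hXU f with h | h
  · exact Or.inl (by simpa using h)
  · exact Or.inr (congrArg Neg.neg h)

lemma isRichterGebert :
    isUniform_topes.toOrientedMatroid.IsRichterGebert leftTope rightTope where
  rank_four := isUniform_topes.hasRank_four
  tope_left := isUniform_topes.isTope_decode (by norm_num) (by decide +kernel)
  tope_right := isUniform_topes.isTope_decode (by norm_num) (by decide +kernel)
  full_support := decode_nil_ne_zero _
  not_both := by
    rintro ⟨M', hM', hU, hT⟩
    have h := isUniform_topes.refutes_eq_false hM' refutation (clausesOf cornerClauses)
    have htrue := refutes_refutation
    rw [eager_eq] at htrue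
    rw [htrue] at h
    refine absurd (h fun c hc => ?_) (by decide)
    rw [clausesOf_eq_map, List.mem_map] at hc
    obtain ⟨l, hl, rfl⟩ := hc
    simp only [cornerClauses, List.mem_cons, List.not_mem_nil, or_false] at hl
    rcases hl with rfl | rfl | rfl | rfl | rfl
    · exact isUniform_topes.holds_corner hM' hU rfl hasCorners_left fun b hb =>
        List.mem_map_of_mem (by simpa using hb)
    -- A pseudoplane that meets a tope also meets its negative, whose corners are the partners; this
    -- excludes that all corners are negative.
    · exact isUniform_topes.holds_corner hM' hU.neg rfl hasCorners_left_neg fun b hb =>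
        List.mem_map_of_mem (f := fun b => 2 * partner (leftCorner b)) (by simpa using hb)
    · exact isUniform_topes.holds_corner hM' hT rfl hasCorners_right fun b hb =>
        List.mem_map_of_mem (by simpa using hb)
    · exact isUniform_topes.holds_corner hM' hT.neg rfl hasCorners_right_neg fun b hb =>
        List.mem_map_of_mem (f := fun b => 2 * partner (rightCorner b)) (by simpa using hb)
    · refine isUniform_topes.holds_corner_pos hM' (decode_nil_ne_zero _) rfl hasCorners_left
        hasCorners_left_neg (fun b _ => partner_div_two _) fun b hb => ?_
      have hb' : b ∈ [0, 1, 2, 3] := by simpa using hb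
      exact ⟨List.mem_flatMap.2 ⟨b, hb', by simp⟩, List.mem_flatMap.2 ⟨b, hb', by simp⟩⟩

end TopeBitmap

theorem exists_isRichterGebert :
    ∃ (M : OrientedMatroid (Fin 12)) (U T : Fin 12 → SignType), M.IsRichterGebert U T :=
  ⟨_, _, _, TopeBitmap.isRichterGebert⟩

theorem mainTheorem8 :
    (∃ (M : OrientedMatroid (Fin 12)) (U T : Fin 12 → SignType), M.IsRichterGebert U T) ∧
    (∀ (M : OrientedMatroid (Fin 12)) (U T : Fin 12 → SignType), M.IsRichterGebert U T →
      (M.reorient {e | U e = -1}).IsAcyclic ∧ ¬ (M.reorient {e | U e = -1}).IsLittle) ∧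
    (∃ L : OrientedMatroid (Fin 12), L.HasRank 4 ∧ L.IsAcyclic ∧ ¬ L.IsLittle) := by
  refine ⟨exists_isRichterGebert, fun M U T h => h.isAcyclic_and_not_isLittle, ?_⟩
  obtain ⟨M, U, T, h⟩ := exists_isRichterGebert
  exact ⟨M.reorient {e | U e = -1}, OrientedMatroid.hasRank_reorient_iff.2 h.rank_four,
    h.isAcyclic_and_not_isLittle⟩
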